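/- All semigroups are strongly continuous one-parameter semigroups of bounded operators on complex Hilbert spaces, indexed by $[0,\infty)$. Let $V_1=(V_{1,t})_{t\ge 0}$ and $V_2=(V_{2,s})_{s\ge 0}$ be commuting semigroups of isometries on a Hilbert space $\mathcal H$, i.e. $V_{1,t}V_{2,s}=V_{2,s}V_{1,t}$ for all $t,s\ge 0$. Definitions. A closed subspace reduces a semigroup if it and its orthogonal complement are invariant under every operator of the semigroup. A semigroup of isometries is completely nonunitary (c.n.u.) if no nonzero reducing subspace exists on which it is a unitary semigroup; a pair of commuting semigroups of isometries is c.n.u. if no nonzero subspace reduces both to unitary semigroups. The pair $(V_1,V_2)$ has a minimal unitary extension, unique up to a unitary fixing $\mathcal H$: a pair of commuting strongly continuous unitary groups $(\overline{V_{1,t}})_{t\in\mathbb R}$, $(\overline{V_{2,s}})_{s\in\mathbb R}$ on a Hilbert space $\overline{\mathcal H}\supseteq\mathcal H$ that extend $V_1$, $V_2$, with $\overline{\mathcal H}=\overline{\operatorname{span}}\{\overline{V_{1,t}}\,\overline{V_{2,s}}h: s,t\in\mathbb R,\ h\in\mathcal H\}$. The dual of $(V_1,V_2)$ is the pair $(\widetilde{V_1},\widetilde{V_2})$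 of commuting semigroups of isometries on $\overline{\mathcal H}\ominus\mathcal H$ given by $\widetilde{V_{i,t}}=(\overline{V_{i,t}})^*|_{\overline{\mathcal H}\ominus\mathcal H}$, $t\ge 0$. The pair $(V_1,V_2)$ is dual doubly commuting if its dual is doubly commuting, i.e. also $\widetilde{V_{1,t}}\,\widetilde{V_{2,s}}^{*}=\widetilde{V_{2,s}}^{*}\,\widetilde{V_{1,t}}$ for all $t,s\ge0$. A bishift-semigroup is a pair that is jointly unitarily equivalent, for some Hilbert space $\mathcal F$, to the pair of right-shift semigroups in the first and in the second variable on $L^2(\mathbb R_+^2,\mathcal F)=L^2(\mathbb R_+^2)\otimes\mathcal F$. A modified-bishift-semigroup is a c.n.u. pair of commuting semigroups of isometries whose dual is a bishift-semigroup. Theorem. Suppose that $(V_1,V_2)$ is dual doubly commuting. Then $\mathcal H$ decomposes as an orthogonal direct sum of (possibly zero) closed subspaces $$\mathcal H=\mathcal H_m\oplus\mathcal H_{p,u}\oplus\mathcal H_{u,p}\oplus\mathcal H_{u,u},$$ each of which reduces both $V_1$ and $V_2$, such that (1) $(V_1,V_2)$ is a modified-bishift-semigroup on $\mathcal H_m$;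 (2) $V_1$ is a c.n.u. semigroup and $V_2$ is a unitary semigroup on $\mathcal H_{p,u}$; (3) $V_1$ is a unitary semigroup and $V_2$ is a c.n.u. semigroup on $\mathcal H_{u,p}$; (4) both $V_1$ and $V_2$ are unitary semigroups on $\mathcal H_{u,u}$. -/

import Mathlib

open scoped NNReal InnerProductSpace
open MeasureTheory

universe u

/-! ## One-parameter semigroups of isometries -/

section Semigroups

variable {H : Type*} [NormedAddCommGroup H] [InnerProductSpace ℂ H]

/-- A strongly continuous one-parameter semigroup of bounded operators. -/
structure IsC0Semigroup (V : ℝ≥0 → H →L[ℂ] H) : Prop where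
  map_zero : V 0 = 1
  map_add : ∀ s t, V (s + t) = V s * V t
  continuous : ∀ x, Continuous fun t => V t x

/-- A strongly continuous semigroup of isometries. -/
structure IsIsometricSemigroup (V : ℝ≥0 → H →L[ℂ] H) : Prop extends IsC0Semigroup V where
  norm_map : ∀ t x, ‖V t x‖ = ‖x‖

/-- A strongly continuous semigroup of unitary operators (surjective isometries). -/
structure IsUnitarySemigroup (V : ℝ≥0 → H →L[ℂ] H) : Prop extends IsIsometricSemigroup V where
  surjective : ∀ t, Function.Surjective (V t)

/-- A strongly continuous one-parameter group of unitary operators. -/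
structure IsUnitaryGroup (U : ℝ → H →L[ℂ] H) : Prop where
  map_zero : U 0 = 1
  map_add : ∀ s t, U (s + t) = U s * U t
  continuous : ∀ x, Continuous fun t => U t x
  norm_map : ∀ t x, ‖U t x‖ = ‖x‖
  surjective : ∀ t, Function.Surjective (U t)

/-- The two semigroups commute. -/
def IsCommutingPair (V₁ V₂ : ℝ≥0 → H →L[ℂ] H) : Prop :=
  ∀ t s, V₁ t * V₂ s = V₂ s * V₁ t

/-- The two semigroups commute, and each commutes with the adjoints of the other. -/
def IsDoublyCommutingPair [CompleteSpace H] (V₁ V₂ : ℝ≥0 → H →L[ℂ] H) : Prop :=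
  IsCommutingPair V₁ V₂ ∧
    ∀ t s, V₁ t * ContinuousLinearMap.adjoint (V₂ s) = ContinuousLinearMap.adjoint (V₂ s) * V₁ t

/-- The subspace `M` is invariant under every operator of the semigroup. -/
def IsInvariantUnder (V : ℝ≥0 → H →L[ℂ] H) (M : Submodule ℂ H) : Prop :=
  ∀ t, ∀ x ∈ M, V t x ∈ M

/-- The semigroup `V|_M` on `M`, for an invariant subspace `M`. -/
def IsInvariantUnder.restrict {V : ℝ≥0 → H →L[ℂ] H} {M : Submodule ℂ H}
    (h : IsInvariantUnder V M) : ℝ≥0 → M →L[ℂ] M :=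
  fun t => (V t).restrict (h t)

/-- The closed subspace `M` reduces `V`: both `M` and its orthogonal complement are invariant. -/
structure Reduces (V : ℝ≥0 → H →L[ℂ] H) (M : Submodule ℂ H) : Prop where
  isClosed : IsClosed (M : Set H)
  invariant : IsInvariantUnder V M
  invariant_orthogonal : IsInvariantUnder V Mᗮ

/-- The semigroup `V|_M` on a reducing subspace `M`. -/
def Reduces.restrict {V : ℝ≥0 → H →L[ℂ] H} {M : Submodule ℂ H}
    (h : Reduces V M) : ℝ≥0 → M →L[ℂ] M :=
  h.invariant.restrict

/-- A completely nonunitary semigroup of isometries: no nonzero reducing subspace on which it is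
a unitary semigroup. -/
structure IsCnuSemigroup (V : ℝ≥0 → H →L[ℂ] H) : Prop extends IsIsometricSemigroup V where
  eq_bot : ∀ (M : Submodule ℂ H) (h : Reduces V M), IsUnitarySemigroup h.restrict → M = ⊥

/-- A completely nonunitary pair of commuting semigroups of isometries: no nonzero subspace
reduces both semigroups to unitary semigroups. -/
structure IsCnuPair (V₁ V₂ : ℝ≥0 → H →L[ℂ] H) : Prop where
  left : IsIsometricSemigroup V₁
  right : IsIsometricSemigroup V₂
  comm : IsCommutingPair V₁ V₂
  eq_bot : ∀ (M : Submodule ℂ H) (h₁ : Reduces V₁ M) (h₂ : Reduces V₂ M),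
    IsUnitarySemigroup h₁.restrict → IsUnitarySemigroup h₂.restrict → M = ⊥

/-- The space is the orthogonal direct sum of the finitely many subspaces `M i`. -/
def IsOrthogonalDirectSum {ι : Type*} [Finite ι] (M : ι → Submodule ℂ H) : Prop :=
  (Pairwise fun i j => M i ⟂ M j) ∧ ⨆ i, M i = ⊤

end Semigroups

/-! ## Minimal unitary extensions and the dual pair -/

section Dual

variable {H : Type u} [NormedAddCommGroup H] [InnerProductSpace ℂ H]

/-- A minimal unitary extension of the pair `(V₁, V₂)`: a Hilbert space `K` containing `H` through
the isometric embedding `J`, and commuting strongly continuous unitary groups `U₁`, `U₂` on `K`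
that extend `V₁`, `V₂`, such that the vectors `U₁ t (U₂ s h)` with `s t : ℝ`, `h ∈ H` span a dense
subspace of `K`. -/
structure MinimalUnitaryExtension (V₁ V₂ : ℝ≥0 → H →L[ℂ] H) where
  K : Type u
  [normedAddCommGroup : NormedAddCommGroup K]
  [innerProductSpace : InnerProductSpace ℂ K]
  [completeSpace : CompleteSpace K]
  J : H →ₗᵢ[ℂ] K
  U₁ : ℝ → K →L[ℂ] K
  U₂ : ℝ → K →L[ℂ] K
  group₁ : IsUnitaryGroup U₁
  group₂ : IsUnitaryGroup U₂
  comm : ∀ t s, U₁ t * U₂ s = U₂ s * U₁ t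
  extends₁ : ∀ (t : ℝ≥0) (h : H), U₁ t (J h) = J (V₁ t h)
  extends₂ : ∀ (t : ℝ≥0) (h : H), U₂ t (J h) = J (V₂ t h)
  minimal : (Submodule.span ℂ {x | ∃ (t s : ℝ) (h : H), x = U₁ t (U₂ s (J h))}).topologicalClosure
    = ⊤

namespace MinimalUnitaryExtension

attribute [instance] normedAddCommGroup innerProductSpace completeSpace

variable {V₁ V₂ : ℝ≥0 → H →L[ℂ] H} (E : MinimalUnitaryExtension V₁ V₂)

/-- The space `K ⊖ H` of the dual pair. -/
noncomputable def dualSpace : Submodule ℂ E.K := (LinearMap.range E.J.toLinearMap)ᗮ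

instance : CompleteSpace E.dualSpace :=
  inferInstanceAs (CompleteSpace (LinearMap.range E.J.toLinearMap)ᗮ)

theorem dual_invariant₁ :
    IsInvariantUnder (fun t : ℝ≥0 => ContinuousLinearMap.adjoint (E.U₁ t)) E.dualSpace := by
  rintro t x hx _ ⟨h, rfl⟩
  rw [ContinuousLinearMap.adjoint_inner_right]
  exact (congrArg (⟪·, x⟫_ℂ) (E.extends₁ t h)).trans (hx _ ⟨V₁ t h, rfl⟩)

theorem dual_invariant₂ :
    IsInvariantUnder (fun t : ℝ≥0 => ContinuousLinearMap.adjoint (E.U₂ t)) E.dualSpace := by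
  rintro t x hx _ ⟨h, rfl⟩
  rw [ContinuousLinearMap.adjoint_inner_right]
  exact (congrArg (⟪·, x⟫_ℂ) (E.extends₂ t h)).trans (hx _ ⟨V₂ t h, rfl⟩)

/-- The first semigroup of the dual pair: the restriction of `(U₁ t)*` to `K ⊖ H`. -/
noncomputable def dual₁ : ℝ≥0 → E.dualSpace →L[ℂ] E.dualSpace := E.dual_invariant₁.restrict

/-- The second semigroup of the dual pair: the restriction of `(U₂ t)*` to `K ⊖ H`. -/
noncomputable def dual₂ : ℝ≥0 → E.dualSpace →L[ℂ] E.dualSpace := E.dual_invariant₂.restrict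

end MinimalUnitaryExtension

/-- The dual of `(V₁, V₂)` is a doubly commuting pair. Every commuting pair of isometric semigroups
on a Hilbert space has a minimal unitary extension
(`nonempty_minimalUnitaryExtension` below), and it is unique up to a unitary that fixes `H`. -/
def IsDualDoublyCommuting (V₁ V₂ : ℝ≥0 → H →L[ℂ] H) : Prop :=
  ∃ E : MinimalUnitaryExtension V₁ V₂, IsDoublyCommutingPair E.dual₁ E.dual₂

end Dual

/-! ## Bishift-semigroups and modified-bishift-semigroups -/

section Bishift

/-- Lebesgue measure on the closed quadrant `[0, ∞) × [0, ∞)`. -/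
noncomputable def quadrantMeasure : Measure (ℝ × ℝ) :=
  volume.restrict (Set.Ici 0 ×ˢ Set.Ici 0)

/-- Right shift by `t` in the first variable. -/
noncomputable def shiftFst {F : Type*} [Zero F] (t : ℝ≥0) (f : ℝ × ℝ → F) : ℝ × ℝ → F :=
  fun p => if (t : ℝ) ≤ p.1 then f (p.1 - t, p.2) else 0

/-- Right shift by `t` in the second variable. -/
noncomputable def shiftSnd {F : Type*} [Zero F] (t : ℝ≥0) (f : ℝ × ℝ → F) : ℝ × ℝ → F :=
  fun p => if (t : ℝ) ≤ p.2 then f (p.1, p.2 - t) else 0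

variable {H : Type u} [NormedAddCommGroup H] [InnerProductSpace ℂ H]

/-- `(V₁, V₂)` is jointly unitarily equivalent, for some Hilbert space `F`, to the pair of
right-shift semigroups in the two variables on `L²(ℝ₊², F) = L²(ℝ₊²) ⊗ F`. -/
def IsBishiftSemigroup (V₁ V₂ : ℝ≥0 → H →L[ℂ] H) : Prop :=
  ∃ (F : Type u) (_ : NormedAddCommGroup F) (_ : InnerProductSpace ℂ F) (_ : CompleteSpace F)
    (W : H ≃ₗᵢ[ℂ] Lp F 2 quadrantMeasure), ∀ (t : ℝ≥0) (x : H),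
      (W (V₁ t x) : ℝ × ℝ → F) =ᵐ[quadrantMeasure] shiftFst t (W x) ∧
      (W (V₂ t x) : ℝ × ℝ → F) =ᵐ[quadrantMeasure] shiftSnd t (W x)

/-- A c.n.u. pair of commuting isometric semigroups whose dual is a bishift-semigroup. -/
def IsModifiedBishiftSemigroup (V₁ V₂ : ℝ≥0 → H →L[ℂ] H) : Prop :=
  IsCnuPair V₁ V₂ ∧
    ∃ E : MinimalUnitaryExtension V₁ V₂, IsBishiftSemigroup E.dual₁ E.dual₂

end Bishift

/-! ## Existence of the minimal unitary extension -/

section Existence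

open Filter Topology

variable {H : Type u} [NormedAddCommGroup H] [InnerProductSpace ℂ H]

namespace UnitaryExtension

/-- The semigroup evaluated at the positive part of `a : ℝ × ℝ`. -/
noncomputable def ev (V₁ V₂ : ℝ≥0 → H →L[ℂ] H) (a : ℝ × ℝ) : H →L[ℂ] H :=
  V₁ a.1.toNNReal * V₂ a.2.toNNReal

theorem ev_add {V₁ V₂ : ℝ≥0 → H →L[ℂ] H} (h₁ : IsIsometricSemigroup V₁)
    (h₂ : IsIsometricSemigroup V₂) (hc : IsCommutingPair V₁ V₂) {a b : ℝ × ℝ}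
    (ha : 0 ≤ a) (hb : 0 ≤ b) : ev V₁ V₂ (a + b) = ev V₁ V₂ a * ev V₁ V₂ b := by
  unfold ev
  rw [Prod.fst_add, Prod.snd_add, Real.toNNReal_add ha.1 hb.1, Real.toNNReal_add ha.2 hb.2,
    h₁.map_add, h₂.map_add]
  have := hc b.1.toNNReal a.2.toNNReal
  simp only [mul_assoc]
  rw [← mul_assoc (V₂ _) (V₁ _), ← this]
  simp only [mul_assoc]

theorem norm_ev {V₁ V₂ : ℝ≥0 → H →L[ℂ] H} (h₁ : IsIsometricSemigroup V₁)
    (h₂ : IsIsometricSemigroup V₂) (a : ℝ × ℝ) (x : H) : ‖ev V₁ V₂ a x‖ = ‖x‖ := by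
  simp [ev, h₁.norm_map, h₂.norm_map]

theorem inner_ev {V₁ V₂ : ℝ≥0 → H →L[ℂ] H} (h₁ : IsIsometricSemigroup V₁)
    (h₂ : IsIsometricSemigroup V₂) (a : ℝ × ℝ) (x y : H) :
    ⟪ev V₁ V₂ a x, ev V₁ V₂ a y⟫_ℂ = ⟪x, y⟫_ℂ :=
  LinearIsometry.inner_map_map ⟨(ev V₁ V₂ a).toLinearMap, norm_ev h₁ h₂ a⟩ x y

/-- Formal combinations of vectors `U a h`, to be completed to the extension space. -/
abbrev Pre (H : Type u) [AddCommGroup H] : Type u := (ℝ × ℝ) →₀ H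

/-- The realization in `H` of `U p f`, meaningful for large `p`. -/
noncomputable def realize (V₁ V₂ : ℝ≥0 → H →L[ℂ] H) (p : ℝ × ℝ) : Pre H →ₗ[ℂ] H :=
  Finsupp.lsum ℂ fun g => (ev V₁ V₂ (g + p)).toLinearMap

theorem realize_single (V₁ V₂ : ℝ≥0 → H →L[ℂ] H) (p g : ℝ × ℝ) (h : H) :
    realize V₁ V₂ p (Finsupp.single g h) = ev V₁ V₂ (g + p) h := by
  simp [realize]

/-- Translation of formal combinations. -/
noncomputable def tr (a : ℝ × ℝ) : Pre H →ₗ[ℂ] Pre H :=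
  Finsupp.lmapDomain H ℂ fun g => a + g

theorem tr_single (a g : ℝ × ℝ) (h : H) :
    tr a (Finsupp.single g h) = Finsupp.single (a + g) h := by
  simp [tr]

theorem tr_add (a b : ℝ × ℝ) (f : Pre H) : tr (a + b) f = tr a (tr b f) := by
  induction f using Finsupp.induction_linear with
  | zero => simp
  | add f g hf hg => simp [hf, hg]
  | single g h => simp [tr_single, add_assoc]

theorem tr_zero (f : Pre H) : tr 0 f = f := by
  induction f using Finsupp.induction_linear with
  | zero => simp
  | add f g hf hg => simp [hf, hg]
  | single g h => simp [tr_single]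

theorem realize_tr (V₁ V₂ : ℝ≥0 → H →L[ℂ] H) (p a : ℝ × ℝ) (f : Pre H) :
    realize V₁ V₂ p (tr a f) = realize V₁ V₂ (p + a) f := by
  induction f using Finsupp.induction_linear with
  | zero => simp
  | add f g hf hg => simp [hf, hg]
  | single g h =>
    rw [tr_single, realize_single, realize_single]
    congr 2
    abel

theorem realize_eventually {V₁ V₂ : ℝ≥0 → H →L[ℂ] H} (h₁ : IsIsometricSemigroup V₁)
    (h₂ : IsIsometricSemigroup V₂) (hc : IsCommutingPair V₁ V₂) (f : Pre H) :
    ∀ᶠ p in atTop, ∀ q ≥ p, realize V₁ V₂ q f = ev V₁ V₂ (q - p) (realize V₁ V₂ p f) := by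
  induction f using Finsupp.induction_linear with
  | zero => simp
  | add f g hf hg =>
    filter_upwards [hf, hg] with p hp hp' q hq
    simp [hp q hq, hp' q hq]
  | single g h =>
    filter_upwards [eventually_ge_atTop (-g)] with p hp q hq
    have hgp : 0 ≤ g + p := by simpa using add_le_add_right hp g
    rw [realize_single, realize_single, ← mul_apply_eq_comp,
      ← ev_add h₁ h₂ hc (sub_nonneg.2 hq) hgp]
    congr 2
    abel

/-- The inner product of formal combinations. -/
noncomputable def ip (V₁ V₂ : ℝ≥0 → H →L[ℂ] H) (f g : Pre H) : ℂ :=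
  limUnder atTop fun p => ⟪realize V₁ V₂ p f, realize V₁ V₂ p g⟫_ℂ

theorem tendsto_ip {V₁ V₂ : ℝ≥0 → H →L[ℂ] H} (h₁ : IsIsometricSemigroup V₁)
    (h₂ : IsIsometricSemigroup V₂) (hc : IsCommutingPair V₁ V₂) (f g : Pre H) :
    Tendsto (fun p => ⟪realize V₁ V₂ p f, realize V₁ V₂ p g⟫_ℂ) atTop (𝓝 (ip V₁ V₂ f g)) := by
  obtain ⟨p, hf, hg⟩ :=
    ((realize_eventually h₁ h₂ hc f).and (realize_eventually h₁ h₂ hc g)).exists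
  refine tendsto_nhds_limUnder ⟨⟪realize V₁ V₂ p f, realize V₁ V₂ p g⟫_ℂ, ?_⟩
  refine tendsto_const_nhds.congr' ?_
  filter_upwards [eventually_ge_atTop p] with q hq
  rw [hf q hq, hg q hq, inner_ev h₁ h₂]

theorem ip_tr {V₁ V₂ : ℝ≥0 → H →L[ℂ] H} (h₁ : IsIsometricSemigroup V₁)
    (h₂ : IsIsometricSemigroup V₂) (hc : IsCommutingPair V₁ V₂) (a : ℝ × ℝ) (f g : Pre H) :
    ip V₁ V₂ (tr a f) (tr a g) = ip V₁ V₂ f g := by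
  refine tendsto_nhds_unique (tendsto_ip h₁ h₂ hc _ _) ?_
  simp only [realize_tr]
  exact (tendsto_ip h₁ h₂ hc f g).comp (tendsto_atTop_add_const_right _ a tendsto_id)

theorem ip_eq {V₁ V₂ : ℝ≥0 → H →L[ℂ] H} (h₁ : IsIsometricSemigroup V₁)
    (h₂ : IsIsometricSemigroup V₂) (hc : IsCommutingPair V₁ V₂) {f g : Pre H} {c : ℂ}
    (h : ∀ p ≥ 0, ⟪realize V₁ V₂ p f, realize V₁ V₂ p g⟫_ℂ = c) : ip V₁ V₂ f g = c :=
  tendsto_nhds_unique (tendsto_ip h₁ h₂ hc _ _) <|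
    tendsto_const_nhds.congr' <| (eventually_ge_atTop 0).mono fun p hp => (h p hp).symm

/-- The semi-inner product on formal combinations. -/
noncomputable abbrev preCore {V₁ V₂ : ℝ≥0 → H →L[ℂ] H} (h₁ : IsIsometricSemigroup V₁)
    (h₂ : IsIsometricSemigroup V₂) (hc : IsCommutingPair V₁ V₂) :
    PreInnerProductSpace.Core ℂ (Pre H) where
  inner := ip V₁ V₂
  conj_inner_symm f g := tendsto_nhds_unique
    ((Complex.continuous_conj.tendsto _).comp (tendsto_ip h₁ h₂ hc g f))
    ((tendsto_ip h₁ h₂ hc f g).congr fun p => (inner_conj_symm _ _).symm)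
  re_inner_nonneg f := ge_of_tendsto' ((Complex.continuous_re.tendsto _).comp
    (tendsto_ip h₁ h₂ hc f f)) fun p => (inner_self_nonneg (𝕜 := ℂ) (x := realize V₁ V₂ p f) :)
  add_left f g k := tendsto_nhds_unique (tendsto_ip h₁ h₂ hc _ _)
    (((tendsto_ip h₁ h₂ hc f k).add (tendsto_ip h₁ h₂ hc g k)).congr fun p => by
      rw [map_add]; exact (inner_add_left _ _ _).symm)
  smul_left f g c := tendsto_nhds_unique (tendsto_ip h₁ h₂ hc _ _)
    (((tendsto_ip h₁ h₂ hc f g).const_mul _).congr fun p => by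
      rw [map_smul]; exact (inner_smul_left _ _ _).symm)

end UnitaryExtension

open UnitaryExtension

/-- Every commuting pair of strongly continuous semigroups of isometries has a minimal unitary
extension. -/
theorem nonempty_minimalUnitaryExtension {V₁ V₂ : ℝ≥0 → H →L[ℂ] H}
    (h₁ : IsIsometricSemigroup V₁) (h₂ : IsIsometricSemigroup V₂) (hc : IsCommutingPair V₁ V₂) :
    Nonempty (MinimalUnitaryExtension V₁ V₂) := by
  let := preCore h₁ h₂ hc
  let : SeminormedAddCommGroup (Pre H) := InnerProductSpace.Core.toSeminormedAddCommGroup (𝕜 := ℂ)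
  let : InnerProductSpace ℂ (Pre H) := InnerProductSpace.ofCore (preCore h₁ h₂ hc)
  have norm_eq (f : Pre H) : ‖f‖ = √(ip V₁ V₂ f f).re := norm_eq_sqrt_re_inner (𝕜 := ℂ) f
  have norm_tr (a : ℝ × ℝ) (f : Pre H) : ‖tr a f‖ = ‖f‖ := by
    rw [norm_eq, norm_eq, ip_tr h₁ h₂ hc]
  let T (a : ℝ × ℝ) : Pre H →L[ℂ] Pre H := (⟨tr a, norm_tr a⟩ : Pre H →ₗᵢ[ℂ] Pre H).toContinuousLinearMap
  have hT (a : ℝ × ℝ) (f : Pre H) : T a f = tr a f := rfl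
  let U (a : ℝ × ℝ) := (T a).completion
  have hU (a : ℝ × ℝ) (f : Pre H) : U a f = ((tr a f : Pre H) : UniformSpace.Completion (Pre H)) := by
    simp [U, hT]
  have U_add (a b : ℝ × ℝ) : U (a + b) = U a * U b := by
    ext x
    induction x using UniformSpace.Completion.induction_on with
    | hp => exact isClosed_eq (U (a + b)).continuous (U a * U b).continuous
    | ih f => rw [mul_apply_eq_comp, hU, hU, hU, tr_add]
  have U_zero : U 0 = 1 := by
    ext x
    induction x using UniformSpace.Completion.induction_on with
    | hp => exact isClosed_eq (U 0).continuous continuous_id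
    | ih f => rw [hU, tr_zero]; rfl
  have U_norm (a : ℝ × ℝ) (x) : ‖U a x‖ = ‖x‖ := by
    induction x using UniformSpace.Completion.induction_on with
    | hp => exact isClosed_eq (U a).continuous.norm continuous_norm
    | ih f => rw [hU, UniformSpace.Completion.norm_coe, UniformSpace.Completion.norm_coe, norm_tr]
  have U_surj (a : ℝ × ℝ) : Function.Surjective (U a) := fun x =>
    ⟨U (-a) x, by rw [← mul_apply_eq_comp, ← U_add, add_neg_cancel, U_zero]; rfl⟩
  let J₀ : H →ₗᵢ[ℂ] Pre H := ⟨Finsupp.lsingle 0, fun h => by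
    have : ip V₁ V₂ (Finsupp.single 0 h) (Finsupp.single 0 h) = ⟪h, h⟫_ℂ :=
      ip_eq h₁ h₂ hc fun p _ => by rw [realize_single, inner_ev h₁ h₂]
    rw [Finsupp.lsingle_apply, norm_eq, this, norm_eq_sqrt_re_inner (𝕜 := ℂ) h]; rfl⟩
  let J : H →ₗᵢ[ℂ] UniformSpace.Completion (Pre H) :=
    UniformSpace.Completion.toComplₗᵢ.comp J₀
  have hJ (h : H) : J h = ((Finsupp.single 0 h : Pre H) : UniformSpace.Completion (Pre H)) := rfl
  have U_J (a : ℝ × ℝ) (h : H) :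
      U a (J h) = ((Finsupp.single a h : Pre H) : UniformSpace.Completion (Pre H)) := by
    rw [hJ, hU, tr_single, add_zero]
  have U_ext (a : ℝ × ℝ) (ha : 0 ≤ a) (h : H) : U a (J h) = J (ev V₁ V₂ a h) := by
    rw [U_J, hJ, ← sub_eq_zero, ← UniformSpace.Completion.coe_sub, ← norm_eq_zero,
      UniformSpace.Completion.norm_coe]
    set f : Pre H := Finsupp.single a h - Finsupp.single 0 (ev V₁ V₂ a h) with hf
    have : ip V₁ V₂ f f = 0 := ip_eq h₁ h₂ hc fun p hp => by
      have : realize V₁ V₂ p f = 0 := by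
        rw [hf, map_sub, realize_single, realize_single, zero_add, add_comm,
          ev_add h₁ h₂ hc hp ha, mul_apply_eq_comp, sub_self]
      rw [this, inner_zero_left]
    rw [norm_eq, this]; simp
  have coe_sum (f : Pre H) : (f : UniformSpace.Completion (Pre H)) ∈
      Submodule.span ℂ {x | ∃ (t s : ℝ) (h : H), x = U (t, 0) (U (0, s) (J h))} := by
    induction f using Finsupp.induction_linear with
    | zero => exact Submodule.zero_mem _
    | add f g hf hg => rw [UniformSpace.Completion.coe_add]; exact Submodule.add_mem _ hf hg
    | single a h =>
      refine Submodule.subset_span ⟨a.1, a.2, h, ?_⟩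
      rw [← mul_apply_eq_comp, ← U_add, U_J]
      simp
  have U_cont (γ : ℝ → ℝ × ℝ) (hγ : Continuous γ) (x) : Continuous fun t => U (γ t) x := by
    have key (f : Pre H) : Continuous fun t => U (γ t) f := by
      induction f using Finsupp.induction_linear with
      | zero =>
        simp only [UniformSpace.Completion.coe_zero, map_zero]
        exact continuous_const
      | add f g hf hg =>
        simp only [UniformSpace.Completion.coe_add, map_add]
        exact hf.add hg
      | single a h =>
        have hev : Continuous fun a : ℝ × ℝ => ev V₁ V₂ a h := by
          have hb : Continuous fun q : ℝ≥0 × ℝ≥0 => V₁ q.1 (V₂ q.2 h) := by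
            refine continuous_iff_continuousAt.2 fun q => ?_
            have l1 : Tendsto (fun r : ℝ≥0 × ℝ≥0 => V₁ r.1 (V₂ q.2 h)) (𝓝 q)
                (𝓝 (V₁ q.1 (V₂ q.2 h))) :=
              (((h₁.continuous _).comp continuous_fst).tendsto q)
            have l2 : Tendsto (fun r : ℝ≥0 × ℝ≥0 => V₁ r.1 (V₂ r.2 h - V₂ q.2 h)) (𝓝 q) (𝓝 0) := by
              rw [tendsto_zero_iff_norm_tendsto_zero]
              simp only [h₁.norm_map]
              have : Continuous fun r : ℝ≥0 × ℝ≥0 => ‖V₂ r.2 h - V₂ q.2 h‖ :=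
                (((h₂.continuous h).comp continuous_snd).sub continuous_const).norm
              simpa using this.tendsto q
            simpa [ContinuousAt] using l1.add l2
          exact hb.comp ((continuous_real_toNNReal.comp continuous_fst).prodMk
            (continuous_real_toNNReal.comp continuous_snd))
        refine continuous_iff_continuousAt.2 fun t₀ => ?_
        set b : ℝ × ℝ := γ t₀ + a - (1, 1) with hb
        have hlt : ∀ᶠ t in 𝓝 t₀, 0 ≤ γ t + a - b := by
          have h1 : ∀ᶠ t in 𝓝 t₀, 0 < (γ t + a - b).1 := by
            refine (isOpen_lt continuous_const (by fun_prop)).mem_nhds ?_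
            simp [hb]
          have h2 : ∀ᶠ t in 𝓝 t₀, 0 < (γ t + a - b).2 := by
            refine (isOpen_lt continuous_const (by fun_prop)).mem_nhds ?_
            simp [hb]
          filter_upwards [h1, h2] with t h1 h2
          exact ⟨h1.le, h2.le⟩
        have hc' : Continuous fun t => U b (J (ev V₁ V₂ (γ t + a - b) h)) :=
          (U b).continuous.comp (J.continuous.comp (hev.comp (by fun_prop)))
        refine hc'.continuousAt.congr ?_
        filter_upwards [hlt] with t ht
        rw [← U_ext _ ht, ← mul_apply_eq_comp, ← U_add, U_J, hU, tr_single]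
        congr 2
        abel
    refine continuous_iff_continuousAt.2 fun t₀ => Metric.continuousAt_iff'.2 fun ε hε => ?_
    obtain ⟨f, hf⟩ := Metric.denseRange_iff.1 UniformSpace.Completion.denseRange_coe x (ε / 3)
      (by positivity)
    filter_upwards [Metric.continuousAt_iff'.1 (key f).continuousAt (ε / 3) (by positivity)]
      with t ht
    have e1 (s : ℝ) : dist (U (γ s) x) (U (γ s) f) < ε / 3 := by
      rwa [dist_eq_norm, ← map_sub, U_norm, ← dist_eq_norm]
    calc dist (U (γ t) x) (U (γ t₀) x) ≤ dist (U (γ t) x) (U (γ t) f)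
          + dist (U (γ t) f) (U (γ t₀) f) + dist (U (γ t₀) f) (U (γ t₀) x) := dist_triangle4 _ _ _ _
      _ < ε / 3 + ε / 3 + ε / 3 := by
          gcongr
          · exact e1 t
          · rw [dist_comm]; exact e1 t₀
      _ = ε := by ring
  exact ⟨{
    K := UniformSpace.Completion (Pre H)
    J := J
    U₁ := fun t => U (t, 0)
    U₂ := fun s => U (0, s)
    group₁ := ⟨U_zero, fun s t => by rw [← U_add]; simp, U_cont _ (by fun_prop),
      fun t => U_norm _, fun t => U_surj _⟩
    group₂ := ⟨U_zero, fun s t => by rw [← U_add]; simp, U_cont _ (by fun_prop),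
      fun t => U_norm _, fun t => U_surj _⟩
    comm := fun t s => by rw [← U_add, ← U_add, add_comm]
    extends₁ := fun t h => by
      rw [U_ext (t, 0) ⟨t.coe_nonneg, le_rfl⟩]
      simp [ev, h₂.map_zero]
    extends₂ := fun t h => by
      rw [U_ext (0, t) ⟨le_rfl, t.coe_nonneg⟩]
      simp [ev, h₁.map_zero]
    minimal := by
      rw [← Submodule.dense_iff_topologicalClosure_eq_top]
      refine UniformSpace.Completion.denseRange_coe.mono ?_
      rintro _ ⟨f, rfl⟩
      exact coe_sum f }⟩

end Existence

/-!
Let `K ⊇ H` carry the minimal unitary extension `(U₁, U₂)` and let `(W₁, W₂)` be the dual pair on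
`D = K ⊖ H`. The Wold decomposition of the doubly commuting pair `(W₁, W₂)` on `D`
induces the decomposition of the orthogonal complement `H` of `D`.

*One semigroup.* Let `V` be an isometric semigroup with resolvent `R = ∫₀^∞ exp (-t) V t dt` and
cogenerator `T = 1 - 2 R`. Differentiating `⟪V s R x, V s R y⟫ = ⟪R x, R y⟫` at `s = 0` shows that
`T` is an isometry, so that `1 - T T*` is the projection onto `ker T*`, which consists of the vectors
`e` with `V t* e = exp (-t) e` for all `t` (`expEigenspace`). If a closed subspace that reduces `V`
contains no such `e`, then `‖V s* R* y‖²` is constant in `s` there, and `V` is unitary on it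
(`IsIsometricSemigroup.apply_adjoint_of_disjoint`).

*The dual pair.* Let `N` be the space of the `e` that are exponential eigenvectors of both `W₁` and
`W₂`. The closed span `A` of the vectors `W₁ s (W₂ t e)` with `e ∈ N` reduces both semigroups, and
so do the subspace `C` on which `W₁` is unitary and the complement `B = (A ⊕ C)ᗮ`. Applying the
criterion above first to `W₁` and then to `W₂` shows that `W₂` is unitary on `B`
(`IsDoublyCommutingPair.pureUnitaryPart_le_unitaryPart`).

*The bishift.* The inner products of the vectors `W₁ s (W₂ t e)` are
`exp (-|s - s'|) exp (-|t - t'|) ⟪e, e'⟫`. The functions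
`2 exp (-(x - s) - (y - t)) e` on `[s, ∞) × [t, ∞)` in `L²(ℝ₊², N)` have the same Gram matrix, they
are total because the quadrants `[s, ∞) × [t, ∞)` generate the Borel sets, and the two right shifts
move `s` and `t`. Hence `(W₁, W₂)` is a bishift on `A` (`isBishiftSemigroup_of_inner_eq`).

*Back to `H`.* The hulls in `K` of `A`, `B`, `C` under the joint group `(U₁, U₂)` are orthogonal, and
the projection onto the hull of `A` maps `D` onto `A`, hence `H` into `H`; the same holds for `B` and
`C`. The summands of `H` are its intersections with the three hulls and with the orthogonal
complement `L` of their sum. Where the dual semigroup `Wᵢ` is unitary, so is `Vᵢ`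
(`IsSplit.isUnitarySemigroup`). A subspace on which the relevant `Vᵢ` are unitary is orthogonal to
the orbit of `A` (or `B`, `C`) and therefore to the hull that contains it, which yields complete
nonunitarity. The joint group acts on the hull of `A` as the minimal unitary extension of the first
summand, with dual space `A`.
-/

open Set Filter Topology
open ContinuousLinearMap (adjoint)

/-! ### The resolvent of a contraction semigroup -/

section Resolvent

variable {H : Type*} [NormedAddCommGroup H] [InnerProductSpace ℂ H]

/-- A strongly continuous one-parameter semigroup of contractions. -/
structure IsContractionSemigroup (S : ℝ≥0 → H →L[ℂ] H) : Prop extends IsC0Semigroup S where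
  norm_le : ∀ t x, ‖S t x‖ ≤ ‖x‖

theorem IsIsometricSemigroup.isContractionSemigroup {V : ℝ≥0 → H →L[ℂ] H}
    (hV : IsIsometricSemigroup V) : IsContractionSemigroup V :=
  { hV with norm_le := fun t x => (hV.norm_map t x).le }

namespace IsContractionSemigroup

variable {S : ℝ≥0 → H →L[ℂ] H} (hS : IsContractionSemigroup S)
include hS

theorem apply_comm (s t : ℝ≥0) (x : H) : S s (S t x) = S t (S s x) := by
  rw [← mul_apply_eq_comp, ← hS.map_add, add_comm, hS.map_add, mul_apply_eq_comp]

theorem continuous_integrand (x : H) :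
    Continuous fun t : ℝ => Real.exp (-t) • S t.toNNReal x :=
  (by fun_prop : Continuous fun t : ℝ => Real.exp (-t)).smul
    ((hS.continuous x).comp continuous_real_toNNReal)

theorem norm_integrand_le (x : H) (t : ℝ) :
    ‖Real.exp (-t) • S t.toNNReal x‖ ≤ Real.exp (-t) * ‖x‖ := by
  rw [norm_smul, Real.norm_eq_abs, Real.abs_exp]
  gcongr
  exact hS.norm_le _ _

theorem integrableOn_integrand (x : H) (a : ℝ) :
    IntegrableOn (fun t : ℝ => Real.exp (-t) • S t.toNNReal x) (Ioi a) :=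
  Integrable.mono' ((integrableOn_exp_neg_Ioi a).mul_const ‖x‖)
    (hS.continuous_integrand x).aestronglyMeasurable
    (ae_of_all _ fun t => hS.norm_integrand_le x t)

/-- The resolvent at `1` of the generator of `S`, that is, the Laplace transform of `S` at `1`. -/
noncomputable def resolvent : H →L[ℂ] H :=
  LinearMap.mkContinuous
    { toFun := fun x => ∫ t in Ioi (0 : ℝ), Real.exp (-t) • S t.toNNReal x
      map_add' := fun x y => by
        rw [← integral_add (hS.integrableOn_integrand x 0) (hS.integrableOn_integrand y 0)]
        simp
      map_smul' := fun c x => by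
        rw [RingHom.id_apply, ← integral_smul]
        simp only [map_smul]
        congr with t
        rw [smul_comm] }
    1 fun x => by
      have := norm_integral_le_of_norm_le ((integrableOn_exp_neg_Ioi 0).mul_const ‖x‖)
        (ae_of_all _ fun t => hS.norm_integrand_le x t)
      rwa [integral_mul_const, integral_exp_neg_Ioi_zero] at this

theorem resolvent_apply (x : H) :
    hS.resolvent x = ∫ t in Ioi (0 : ℝ), Real.exp (-t) • S t.toNNReal x := rfl

theorem inner_resolvent [CompleteSpace H] (y x : H) : ⟪y, hS.resolvent x⟫_ℂ =
    ∫ t in Ioi (0 : ℝ), ⟪y, Real.exp (-t) • S t.toNNReal x⟫_ℂ := by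
  rw [resolvent_apply, integral_inner (hS.integrableOn_integrand x 0)]

theorem resolvent_mem [CompleteSpace H] {M : Submodule ℂ H} (hM : IsClosed (M : Set H))
    (hSM : ∀ t, ∀ x ∈ M, S t x ∈ M) {x : H} (hx : x ∈ M) : hS.resolvent x ∈ M := by
  have : CompleteSpace M := hM.completeSpace_coe
  rw [← M.orthogonal_orthogonal]
  intro y hy
  rw [hS.inner_resolvent]
  refine integral_eq_zero_of_ae (ae_of_all _ fun t => ?_)
  exact Submodule.inner_left_of_mem_orthogonal (M.smul_of_tower_mem _ (hSM _ x hx)) hy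

variable [CompleteSpace H]

theorem apply_resolvent (s : ℝ≥0) (x : H) :
    S s (hS.resolvent x) = hS.resolvent (S s x) := by
  rw [resolvent_apply, ← ContinuousLinearMap.integral_comp_comm _ (hS.integrableOn_integrand x 0),
    resolvent_apply]
  congr with t
  rw [ContinuousLinearMap.map_smul_of_tower, hS.apply_comm]

theorem apply_resolvent_eq (s : ℝ) (hs : 0 ≤ s) (x : H) :
    S s.toNNReal (hS.resolvent x) = Real.exp s •
      (hS.resolvent x - ∫ t in (0 : ℝ)..s, Real.exp (-t) • S t.toNNReal x) := by
  set f : ℝ → H := fun t => Real.exp (-t) • S t.toNNReal x with hf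
  have h1 : hS.resolvent x - ∫ t in (0 : ℝ)..s, f t = ∫ t in Ioi s, f t := by
    rw [resolvent_apply, ← intervalIntegral.integral_interval_add_Ioi (hS.integrableOn_integrand x 0)
      (hS.integrableOn_integrand x s), add_sub_cancel_left]
  have h2 : ∫ t in Ioi s, f t = ∫ t in Ioi (0 : ℝ), f (t + s) := by
    rw [← (measurePreserving_add_right volume s).setIntegral_preimage_emb
      (measurableEmbedding_addRight s) f (Ioi s)]
    simp
  rw [h1, h2, ← integral_smul, resolvent_apply,
    ← ContinuousLinearMap.integral_comp_comm _ (hS.integrableOn_integrand x 0)]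
  refine setIntegral_congr_fun measurableSet_Ioi fun t ht => ?_
  simp only [hf, smul_smul]
  rw [ContinuousLinearMap.map_smul_of_tower, ← mul_apply_eq_comp, ← hS.map_add, ← Real.exp_add,
    Real.toNNReal_add (le_of_lt ht) hs, add_comm s.toNNReal]
  congr 2
  ring

/-- The resolvent maps into the domain of the generator, which sends `R x` to `R x - x`. -/
theorem hasDerivWithinAt_resolvent (x : H) {s : ℝ} (hs : 0 ≤ s) :
    HasDerivWithinAt (fun s : ℝ => S s.toNNReal (hS.resolvent x))
      (S s.toNNReal (hS.resolvent x - x)) (Ici s) s := by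
  have hc := hS.continuous_integrand x
  have hd := (Real.hasDerivAt_exp s).smul
    ((intervalIntegral.integral_hasDerivAt_right (hc.intervalIntegrable 0 s)
      (hc.stronglyMeasurableAtFilter _ _) hc.continuousAt).const_sub (hS.resolvent x))
  refine (hd.hasDerivWithinAt (s := Ici s)).congr_of_eventuallyEq ?_ ?_ |>.congr_deriv ?_
  · filter_upwards [self_mem_nhdsWithin] with t ht
    exact hS.apply_resolvent_eq t (hs.trans ht) x
  · exact hS.apply_resolvent_eq s hs x
  · rw [← hS.apply_resolvent_eq s hs x, smul_neg, smul_smul, ← Real.exp_add, add_neg_cancel,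
      Real.exp_zero, one_smul, map_sub]
    abel

theorem resolvent_eq_zero {x : H} (hx : hS.resolvent x = 0) : x = 0 := by
  have h := hS.hasDerivWithinAt_resolvent x le_rfl
  have h0 : HasDerivWithinAt (fun s : ℝ => S s.toNNReal (hS.resolvent x)) 0 (Ici 0) 0 := by
    simpa [hx] using hasDerivWithinAt_const (0 : ℝ) (Ici (0 : ℝ)) (0 : H)
  simpa [hx, hS.map_zero] using (uniqueDiffWithinAt_Ici 0).eq_deriv _ h h0

end IsContractionSemigroup

end Resolvent

/-! ### Isometric semigroups, their adjoints, and the exponential eigenspace -/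

section Isometric

variable {H : Type*} [NormedAddCommGroup H] [InnerProductSpace ℂ H]

/-- The vectors `e` with `V t* e = exp (-t) e` for all `t`; for the shift semigroup on `L²(ℝ₊, F)`
these are the functions `x ↦ exp (-x) f`. It is the kernel of the adjoint of the cogenerator. -/
noncomputable def expEigenspace [CompleteSpace H] (V : ℝ≥0 → H →L[ℂ] H) : Submodule ℂ H where
  carrier := {e | ∀ t : ℝ≥0, adjoint (V t) e = Real.exp (-t) • e}
  add_mem' ha hb t := by rw [map_add, ha t, hb t, smul_add]
  zero_mem' t := by simp
  smul_mem' c x hx t := by rw [map_smul, hx t, smul_comm]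

namespace IsIsometricSemigroup

variable {V : ℝ≥0 → H →L[ℂ] H} (hV : IsIsometricSemigroup V)
include hV

theorem inner_map_map (t : ℝ≥0) (x y : H) : ⟪V t x, V t y⟫_ℂ = ⟪x, y⟫_ℂ :=
  LinearIsometry.inner_map_map ⟨(V t).toLinearMap, hV.norm_map t⟩ x y

variable [CompleteSpace H]

omit hV in
theorem mem_expEigenspace {e : H} :
    e ∈ expEigenspace V ↔ ∀ t : ℝ≥0, adjoint (V t) e = Real.exp (-t) • e := Iff.rfl

theorem adjoint_apply_self (t : ℝ≥0) (x : H) : adjoint (V t) (V t x) = x :=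
  ext_inner_left ℂ fun y => by rw [ContinuousLinearMap.adjoint_inner_right, hV.inner_map_map]

theorem adjoint_add (s t : ℝ≥0) : adjoint (V (s + t)) = adjoint (V s) * adjoint (V t) := by
  rw [add_comm, hV.map_add]
  exact ContinuousLinearMap.adjoint_comp _ _

omit [CompleteSpace H] in
theorem map_add_apply (s t : ℝ≥0) (x : H) : V (s + t) x = V s (V t x) := by
  rw [hV.map_add]; rfl

theorem adjoint_add_apply (s t : ℝ≥0) (x : H) :
    adjoint (V (s + t)) x = adjoint (V s) (adjoint (V t) x) := by
  rw [hV.adjoint_add]; rfl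

theorem norm_adjoint_le (t : ℝ≥0) (x : H) : ‖adjoint (V t) x‖ ≤ ‖x‖ := by
  have h : ‖V t‖ ≤ 1 := (V t).opNorm_le_bound zero_le_one fun x => by rw [hV.norm_map, one_mul]
  calc ‖adjoint (V t) x‖ ≤ ‖adjoint (V t)‖ * ‖x‖ := ContinuousLinearMap.le_opNorm _ _
    _ ≤ 1 * ‖x‖ := by gcongr; rwa [LinearIsometryEquiv.norm_map]
    _ = ‖x‖ := one_mul _

/-- If `V t*` preserves the norm of `x`, then `x` is in the range of `V t`. -/
theorem apply_adjoint_eq {t : ℝ≥0} {x : H} (h : ‖adjoint (V t) x‖ = ‖x‖) :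
    V t (adjoint (V t) x) = x := by
  have h1 : ⟪V t (adjoint (V t) x), x⟫_ℂ = (‖x‖ : ℂ) ^ 2 := by
    rw [← ContinuousLinearMap.adjoint_inner_right, inner_self_eq_norm_sq_to_K, h]; rfl
  have h2 : ‖V t (adjoint (V t) x) - x‖ ^ 2 = 0 := by
    rw [@norm_sub_sq ℂ, h1, hV.norm_map, h, ← Complex.ofReal_pow]
    simp only [RCLike.re_to_complex, Complex.ofReal_re]
    ring
  exact sub_eq_zero.1 (norm_eq_zero.1 (pow_eq_zero_iff two_ne_zero |>.1 h2))

/-- Since `V h* V h = 1`, the strong continuity of `V` passes to the adjoints: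
`‖V (s + h)* x - V s* x‖ ≤ ‖x - V h x‖`. -/
theorem isContractionSemigroup_adjoint : IsContractionSemigroup fun t => adjoint (V t) where
  map_zero := by rw [hV.map_zero]; exact star_one _
  map_add := hV.adjoint_add
  norm_le := hV.norm_adjoint_le
  continuous x := by
    have key (s t : ℝ≥0) (hst : s ≤ t) :
        ‖adjoint (V t) x - adjoint (V s) x‖ ≤ ‖x - V (t - s) x‖ := by
      obtain ⟨h, rfl⟩ := exists_add_of_le hst
      rw [add_tsub_cancel_left, hV.adjoint_add_apply, ← map_sub]
      refine (hV.norm_adjoint_le _ _).trans ?_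
      nth_rw 2 [← hV.adjoint_apply_self h x]
      rw [← map_sub]
      exact hV.norm_adjoint_le _ _
    have key' (s t : ℝ≥0) : ‖adjoint (V t) x - adjoint (V s) x‖ ≤ ‖x - V (nndist t s) x‖ := by
      rcases le_total s t with h | h
      · convert key s t h using 4
        rw [NNReal.nndist_eq, tsub_eq_zero_of_le h, max_eq_left zero_le]
      · rw [norm_sub_rev]
        convert key t s h using 4
        rw [NNReal.nndist_eq, tsub_eq_zero_of_le h, max_eq_right zero_le]
    refine continuous_iff_continuousAt.2 fun s => ?_
    rw [ContinuousAt, tendsto_iff_norm_sub_tendsto_zero]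
    refine squeeze_zero (fun _ => norm_nonneg _) (key' s) ?_
    have : Continuous fun t : ℝ≥0 => ‖x - V (nndist t s) x‖ :=
      (continuous_const.sub ((hV.continuous x).comp (by fun_prop))).norm
    simpa [hV.map_zero] using this.tendsto s

/-- The resolvent of the adjoint semigroup. -/
noncomputable abbrev resolventAdjoint : H →L[ℂ] H := hV.isContractionSemigroup_adjoint.resolvent

/-- The resolvent at `1`. -/
noncomputable abbrev resolvent : H →L[ℂ] H := hV.isContractionSemigroup.resolvent

theorem inner_resolvent_left (x y : H) :
    ⟪hV.resolvent x, y⟫_ℂ = ⟪x, hV.resolventAdjoint y⟫_ℂ := by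
  rw [← inner_conj_symm, IsContractionSemigroup.inner_resolvent,
    IsContractionSemigroup.inner_resolvent, ← integral_conj]
  congr with t
  rw [inner_conj_symm, ← Complex.coe_smul, ← Complex.coe_smul, inner_smul_left, inner_smul_right,
    Complex.conj_ofReal, ContinuousLinearMap.adjoint_inner_right]

theorem inner_resolvent_right (x y : H) :
    ⟪x, hV.resolvent y⟫_ℂ = ⟪hV.resolventAdjoint x, y⟫_ℂ := by
  rw [← inner_conj_symm, inner_resolvent_left, inner_conj_symm]

/-- The identity `R + R* = 2 R* R`, which says that the cogenerator `1 - 2 R` is an isometry. -/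
theorem resolvent_add_adjoint (y : H) :
    hV.resolvent y + hV.resolventAdjoint y = (2 : ℂ) • hV.resolventAdjoint (hV.resolvent y) := by
  refine ext_inner_left ℂ fun x => ?_
  have h1 := (hV.isContractionSemigroup.hasDerivWithinAt_resolvent x le_rfl).inner ℂ
    (hV.isContractionSemigroup.hasDerivWithinAt_resolvent y le_rfl)
  simp only [hV.inner_map_map] at h1
  have h2 := (uniqueDiffWithinAt_Ici 0).eq_deriv _ h1 (hasDerivWithinAt_const _ _ _)
  simp only [inner_sub_left, inner_sub_right] at h2
  rw [inner_smul_right, ← hV.inner_resolvent_left, inner_add_right, ← hV.inner_resolvent_left]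
  linear_combination -h2

/-- The kernel of the adjoint cogenerator `1 - 2 R*` is the exponential eigenspace. -/
theorem mem_expEigenspace_of_resolventAdjoint {e : H} (he : e = (2 : ℂ) • hV.resolventAdjoint e) :
    e ∈ expEigenspace V := by
  intro t
  have hS := hV.isContractionSemigroup_adjoint
  have he' (s : ℝ≥0) : adjoint (V s) e = (2 : ℂ) • adjoint (V s) (hV.resolventAdjoint e) :=
    (congrArg _ he).trans (map_smul _ _ _)
  have hd (s : ℝ) (hs : 0 ≤ s) : HasDerivWithinAt
      (fun s : ℝ => Real.exp s • adjoint (V s.toNNReal) e) 0 (Ici s) s := by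
    have h := (Real.hasDerivAt_exp s).hasDerivWithinAt (s := Ici s) |>.smul
      ((hS.hasDerivWithinAt_resolvent e hs).const_smul (2 : ℂ))
    refine (h.congr_deriv ?_).congr_of_eventuallyEq (Eventually.of_forall fun s => ?_) ?_
    · simp only [Pi.smul_apply, map_sub, smul_sub, ← he' s.toNNReal]
      rw [two_smul]
      module
    · simp only [Pi.smul_apply', Pi.smul_apply, ← he' s.toNNReal]
    · simp only [Pi.smul_apply', Pi.smul_apply, ← he' s.toNNReal]
  have hc : Continuous fun s : ℝ => Real.exp s • adjoint (V s.toNNReal) e :=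
    Real.continuous_exp.smul ((hS.continuous e).comp continuous_real_toNNReal)
  have := constant_of_has_deriv_right_zero (a := 0) (b := t) hc.continuousOn
    (fun s hs => hd s hs.1) t ⟨t.2, le_rfl⟩
  simp only [Real.toNNReal_coe, Real.exp_zero, Real.toNNReal_zero, one_smul] at this
  rw [hS.map_zero, one_apply_eq_self] at this
  nth_rw 2 [← this]
  rw [smul_smul, ← Real.exp_add, neg_add_cancel, Real.exp_zero, one_smul]

/-- The defect operator `1 - T T*` of the cogenerator `T = 1 - 2 R` maps into the kernel of `T*`. -/
theorem defect_mem_expEigenspace (x : H) :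
    (hV.resolvent x + hV.resolventAdjoint x - (2 : ℂ) • hV.resolvent (hV.resolventAdjoint x)) ∈
      expEigenspace V := by
  apply hV.mem_expEigenspace_of_resolventAdjoint
  have h1 := hV.resolvent_add_adjoint x
  have h2 := hV.resolvent_add_adjoint (hV.resolventAdjoint x)
  simp only [map_sub, map_add, map_smul, smul_sub, smul_add]
  rw [← h2, h1]
  module

/-- Let `M` be a closed subspace invariant under all `V t` and `V t*` that contains no exponential
eigenvector. Then the operators `V t` are unitary on `M`: the vanishing of the defect of the
cogenerator makes `s ↦ ‖V s* R* y‖²` constant, so `V t V t*` fixes `R* y` for `y` in `M`. -/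
theorem apply_adjoint_of_disjoint {M : Submodule ℂ H} (hM : IsClosed (M : Set H))
    (hVM : ∀ t, ∀ x ∈ M, V t x ∈ M) (hVM' : ∀ t, ∀ x ∈ M, adjoint (V t) x ∈ M)
    (hN : Disjoint M (expEigenspace V)) (t : ℝ≥0) {x : H} (hx : x ∈ M) :
    V t (adjoint (V t) x) = x := by
  have hS := hV.isContractionSemigroup_adjoint
  have hR {y : H} (hy : y ∈ M) : hV.resolvent y ∈ M :=
    hV.isContractionSemigroup.resolvent_mem hM hVM hy
  have hR' {y : H} (hy : y ∈ M) : hV.resolventAdjoint y ∈ M := hS.resolvent_mem hM hVM' hy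
  have hQ {y : H} (hy : y ∈ M) : hV.resolvent y + hV.resolventAdjoint y =
      (2 : ℂ) • hV.resolvent (hV.resolventAdjoint y) :=
    sub_eq_zero.1 <| Submodule.disjoint_def.1 hN _
      (M.sub_mem (M.add_mem (hR hy) (hR' hy)) (M.smul_mem _ (hR (hR' hy))))
      (hV.defect_mem_expEigenspace y)
  have hfix {y : H} (hy : y ∈ M) :
      V t (adjoint (V t) (hV.resolventAdjoint y)) = hV.resolventAdjoint y := by
    apply hV.apply_adjoint_eq
    have hd (s : ℝ) (hs : 0 ≤ s) : HasDerivWithinAt (fun s : ℝ =>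
        ⟪adjoint (V s.toNNReal) (hV.resolventAdjoint y),
          adjoint (V s.toNNReal) (hV.resolventAdjoint y)⟫_ℂ) 0 (Ici s) s := by
      have h := hS.hasDerivWithinAt_resolvent y hs
      refine (h.inner ℂ h).congr_deriv ?_
      have hz := hVM' s.toNNReal y hy
      simp only [map_sub, hS.apply_resolvent]
      set z := adjoint (V s.toNNReal) y
      have h1 := congrArg (fun w => ⟪z, w⟫_ℂ) (hQ hz)
      simp only [inner_add_right, inner_smul_right, hV.inner_resolvent_right] at h1
      simp only [inner_sub_left, inner_sub_right]
      linear_combination -h1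
    have hc : Continuous fun s : ℝ => ⟪adjoint (V s.toNNReal) (hV.resolventAdjoint y),
          adjoint (V s.toNNReal) (hV.resolventAdjoint y)⟫_ℂ :=
      have h := (hS.continuous (hV.resolventAdjoint y)).comp continuous_real_toNNReal
      h.inner h
    have := constant_of_has_deriv_right_zero (a := 0) (b := t) hc.continuousOn
      (fun s hs => hd s hs.1) t ⟨t.2, le_rfl⟩
    simp only [Real.toNNReal_coe, Real.toNNReal_zero] at this
    rw [hS.map_zero, one_apply_eq_self, inner_self_eq_norm_sq_to_K,
      inner_self_eq_norm_sq_to_K] at this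
    norm_cast at this
    exact (pow_left_inj₀ (norm_nonneg _) (norm_nonneg _) two_ne_zero).1 this
  have hmem : x - V t (adjoint (V t) x) ∈ M := M.sub_mem hx (hVM t _ (hVM' t _ hx))
  refine (sub_eq_zero.1 (hV.isContractionSemigroup.resolvent_eq_zero ?_)).symm
  have h0 {y : H} (hy : y ∈ M) : ⟪hV.resolvent (x - V t (adjoint (V t) x)), y⟫_ℂ = 0 := by
    rw [hV.inner_resolvent_left, inner_sub_left, ← ContinuousLinearMap.adjoint_inner_right,
      ContinuousLinearMap.adjoint_inner_left, hfix hy, sub_self]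
  exact inner_self_eq_zero.1 (h0 (hR hmem))

end IsIsometricSemigroup

end Isometric

/-! ### Subspaces invariant under a semigroup and its adjoint -/

section StarInvariant

variable {H : Type*} [NormedAddCommGroup H] [InnerProductSpace ℂ H] [CompleteSpace H]

/-- The subspace `M`, which need not be closed, is invariant under all `V t` and all `V t*`. -/
structure StarInvariant (V : ℝ≥0 → H →L[ℂ] H) (M : Submodule ℂ H) : Prop where
  apply_mem : ∀ t, ∀ x ∈ M, V t x ∈ M
  adjoint_mem : ∀ t, ∀ x ∈ M, adjoint (V t) x ∈ M

namespace StarInvariant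

variable {V : ℝ≥0 → H →L[ℂ] H} {M N : Submodule ℂ H}

theorem orthogonal (h : StarInvariant V M) : StarInvariant V Mᗮ where
  apply_mem t x hx y hy := by
    rw [← ContinuousLinearMap.adjoint_inner_left]
    exact hx _ (h.adjoint_mem t y hy)
  adjoint_mem t x hx y hy := by
    rw [ContinuousLinearMap.adjoint_inner_right]
    exact hx _ (h.apply_mem t y hy)

theorem inf (h : StarInvariant V M) (h' : StarInvariant V N) : StarInvariant V (M ⊓ N) where
  apply_mem t x hx := ⟨h.apply_mem t x hx.1, h'.apply_mem t x hx.2⟩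
  adjoint_mem t x hx := ⟨h.adjoint_mem t x hx.1, h'.adjoint_mem t x hx.2⟩

theorem sup (h : StarInvariant V M) (h' : StarInvariant V N) : StarInvariant V (M ⊔ N) where
  apply_mem t x hx := by
    obtain ⟨y, hy, z, hz, rfl⟩ := Submodule.mem_sup.1 hx
    rw [map_add]
    exact Submodule.add_mem_sup (h.apply_mem t y hy) (h'.apply_mem t z hz)
  adjoint_mem t x hx := by
    obtain ⟨y, hy, z, hz, rfl⟩ := Submodule.mem_sup.1 hx
    rw [map_add]
    exact Submodule.add_mem_sup (h.adjoint_mem t y hy) (h'.adjoint_mem t z hz)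

end StarInvariant

omit [CompleteSpace H] in
/-- An operator that maps a set into the closed span of the set leaves the closed span invariant. -/
theorem apply_mem_topologicalClosure_span {s : Set H} (T : H →L[ℂ] H)
    (h : ∀ x ∈ s, T x ∈ (Submodule.span ℂ s).topologicalClosure) {x : H}
    (hx : x ∈ (Submodule.span ℂ s).topologicalClosure) :
    T x ∈ (Submodule.span ℂ s).topologicalClosure := by
  have : (Submodule.span ℂ s).topologicalClosure ≤
      (Submodule.span ℂ s).topologicalClosure.comap T.toLinearMap := by
    refine Submodule.topologicalClosure_minimal _ (Submodule.span_le.2 h) ?_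
    exact (Submodule.isClosed_topologicalClosure _).preimage T.continuous
  exact this hx

end StarInvariant

/-! ### The Wold decomposition of a doubly commuting pair -/

section Wold

variable {H : Type*} [NormedAddCommGroup H] [InnerProductSpace ℂ H] [CompleteSpace H]

theorem isClosed_expEigenspace (V : ℝ≥0 → H →L[ℂ] H) :
    IsClosed (expEigenspace V : Set H) := by
  have : (expEigenspace V : Set H) =
      ⋂ t : ℝ≥0, {e | adjoint (V t) e = Real.exp (-t) • e} := by
    ext e; simp [IsIsometricSemigroup.mem_expEigenspace]
  rw [this]
  exact isClosed_iInter fun t => isClosed_eq (by fun_prop) (by fun_prop)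

/-- The subspace on which the isometric semigroup `V` is unitary. -/
noncomputable def unitaryPart (V : ℝ≥0 → H →L[ℂ] H) : Submodule ℂ H where
  carrier := {x | ∀ t, V t (adjoint (V t) x) = x}
  add_mem' ha hb t := by rw [map_add, map_add, ha t, hb t]
  zero_mem' t := by simp
  smul_mem' c x hx t := by rw [map_smul, map_smul, hx t]

theorem mem_unitaryPart {V : ℝ≥0 → H →L[ℂ] H} {x : H} :
    x ∈ unitaryPart V ↔ ∀ t, V t (adjoint (V t) x) = x := Iff.rfl

theorem isClosed_unitaryPart (V : ℝ≥0 → H →L[ℂ] H) : IsClosed (unitaryPart V : Set H) := by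
  have : (unitaryPart V : Set H) = ⋂ t : ℝ≥0, {x | V t (adjoint (V t) x) = x} := by
    ext e; simp [mem_unitaryPart]
  rw [this]
  exact isClosed_iInter fun t => isClosed_eq (by fun_prop) (by fun_prop)

namespace IsIsometricSemigroup

variable {V : ℝ≥0 → H →L[ℂ] H} (hV : IsIsometricSemigroup V)
include hV

theorem adjoint_apply_of_le {s t : ℝ≥0} (h : t ≤ s) (x : H) :
    adjoint (V t) (V s x) = V (s - t) x := by
  conv_lhs => rw [← add_tsub_cancel_of_le h]
  rw [hV.map_add_apply, hV.adjoint_apply_self]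

theorem adjoint_apply_of_ge {s t : ℝ≥0} (h : s ≤ t) (x : H) :
    adjoint (V t) (V s x) = adjoint (V (t - s)) x := by
  conv_lhs => rw [← tsub_add_cancel_of_le h]
  rw [hV.adjoint_add_apply, hV.adjoint_apply_self]

theorem starInvariant_unitaryPart : StarInvariant V (unitaryPart V) where
  apply_mem s x hx t := by
    rcases le_total t s with h | h
    · rw [hV.adjoint_apply_of_le h, ← hV.map_add_apply, add_tsub_cancel_of_le h]
    · rw [hV.adjoint_apply_of_ge h]
      conv_lhs => rw [← add_tsub_cancel_of_le h]
      rw [hV.map_add_apply, add_tsub_cancel_left, hx]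
  adjoint_mem s x hx t := by
    rw [← hV.adjoint_add_apply]
    have := hx (s + t)
    rw [hV.map_add_apply, add_comm] at this
    conv_rhs => rw [← this]
    rw [add_comm, hV.adjoint_apply_self]

theorem inner_apply_expEigenspace {e f : H} (he : e ∈ expEigenspace V) (hf : f ∈ expEigenspace V)
    (s t : ℝ≥0) : ⟪V s e, V t f⟫_ℂ = (Real.exp (-|(s : ℝ) - t|) : ℂ) * ⟪e, f⟫_ℂ := by
  rcases le_total s t with h | h
  · rw [← ContinuousLinearMap.adjoint_inner_right, hV.adjoint_apply_of_le h,
      ← ContinuousLinearMap.adjoint_inner_left, he, ← Complex.coe_smul, inner_smul_left,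
      Complex.conj_ofReal, NNReal.coe_sub h, abs_sub_comm,
      abs_of_nonneg (sub_nonneg.2 (NNReal.coe_le_coe.2 h))]
  · rw [← ContinuousLinearMap.adjoint_inner_left, hV.adjoint_apply_of_le h,
      ← ContinuousLinearMap.adjoint_inner_right, hf, ← Complex.coe_smul, inner_smul_right,
      NNReal.coe_sub h, abs_of_nonneg (sub_nonneg.2 (NNReal.coe_le_coe.2 h))]

/-- An exponential eigenvector `e` is orthogonal to the unitary part, because
`⟪e, x⟫ = exp (-t) ⟪e, V t* x⟫` for all `t` and every `x` in the unitary part. -/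
theorem inner_expEigenspace_unitaryPart {e x : H} (he : e ∈ expEigenspace V)
    (hx : x ∈ unitaryPart V) : ⟪e, x⟫_ℂ = 0 := by
  have h (t : ℝ≥0) : ‖⟪e, x⟫_ℂ‖ ≤ Real.exp (-t) * (‖e‖ * ‖x‖) := by
    conv_lhs => rw [← hx t]
    rw [← ContinuousLinearMap.adjoint_inner_left, he, ← Complex.coe_smul, inner_smul_left,
      Complex.conj_ofReal, norm_mul, Complex.norm_real, Real.norm_eq_abs, Real.abs_exp]
    gcongr
    refine (norm_inner_le_norm _ _).trans ?_
    gcongr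
    exact hV.norm_adjoint_le t x
  have hlim : Tendsto (fun t : ℝ≥0 => Real.exp (-t) * (‖e‖ * ‖x‖)) atTop (𝓝 0) := by
    have : Tendsto (fun t : ℝ≥0 => (t : ℝ)) atTop atTop := NNReal.tendsto_coe_atTop.2 tendsto_id
    simpa using (Real.tendsto_exp_neg_atTop_nhds_zero.comp this).mul_const (‖e‖ * ‖x‖)
  exact norm_le_zero_iff.1 (ge_of_tendsto' hlim h)

end IsIsometricSemigroup

namespace IsDoublyCommutingPair

variable {V₁ V₂ : ℝ≥0 → H →L[ℂ] H} (h : IsDoublyCommutingPair V₁ V₂)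
include h

theorem apply_apply (t s : ℝ≥0) (x : H) : V₁ t (V₂ s x) = V₂ s (V₁ t x) :=
  DFunLike.congr_fun (h.1 t s) x

theorem apply_adjoint (t s : ℝ≥0) (x : H) :
    V₁ t (adjoint (V₂ s) x) = adjoint (V₂ s) (V₁ t x) :=
  DFunLike.congr_fun (h.2 t s) x

theorem adjoint_apply (t s : ℝ≥0) (x : H) :
    adjoint (V₁ t) (V₂ s x) = V₂ s (adjoint (V₁ t) x) :=
  ext_inner_left ℂ fun y => by
    rw [ContinuousLinearMap.adjoint_inner_right, ← ContinuousLinearMap.adjoint_inner_left,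
      ← h.apply_adjoint, ← ContinuousLinearMap.adjoint_inner_right,
      ContinuousLinearMap.adjoint_inner_left]

theorem adjoint_adjoint (t s : ℝ≥0) (x : H) :
    adjoint (V₁ t) (adjoint (V₂ s) x) = adjoint (V₂ s) (adjoint (V₁ t) x) :=
  ext_inner_left ℂ fun y => by
    simp only [ContinuousLinearMap.adjoint_inner_right, h.apply_apply]

theorem symm : IsDoublyCommutingPair V₂ V₁ :=
  ⟨fun t s => (h.1 s t).symm, fun t s => ContinuousLinearMap.ext fun x =>
    (h.adjoint_apply s t x).symm⟩

theorem starInvariant_expEigenspace : StarInvariant V₂ (expEigenspace V₁) where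
  apply_mem t x hx s := by
    rw [h.adjoint_apply, hx, ContinuousLinearMap.map_smul_of_tower]
  adjoint_mem t x hx s := by
    rw [h.adjoint_adjoint, hx, ContinuousLinearMap.map_smul_of_tower]

theorem starInvariant_unitaryPart : StarInvariant V₂ (unitaryPart V₁) where
  apply_mem t x hx s := by rw [h.adjoint_apply, h.apply_apply, hx]
  adjoint_mem t x hx s := by rw [h.adjoint_adjoint, h.apply_adjoint, hx]

end IsDoublyCommutingPair

/-- The closed span of the vectors `V₁ s (V₂ t e)` where `e` is an exponential eigenvector of both
semigroups. For a doubly commuting pair this is the part on which the pair is a bishift. -/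
noncomputable def bishiftPart (V₁ V₂ : ℝ≥0 → H →L[ℂ] H) : Submodule ℂ H :=
  (Submodule.span ℂ {x | ∃ (s t : ℝ≥0), ∃ e ∈ expEigenspace V₁ ⊓ expEigenspace V₂,
    x = V₁ s (V₂ t e)}).topologicalClosure

theorem isClosed_bishiftPart (V₁ V₂ : ℝ≥0 → H →L[ℂ] H) :
    IsClosed (bishiftPart V₁ V₂ : Set H) := Submodule.isClosed_topologicalClosure _

theorem mem_bishiftPart (V₁ V₂ : ℝ≥0 → H →L[ℂ] H) {e : H} (s t : ℝ≥0)
    (he : e ∈ expEigenspace V₁ ⊓ expEigenspace V₂) :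
    V₁ s (V₂ t e) ∈ bishiftPart V₁ V₂ :=
  Submodule.le_topologicalClosure _ (Submodule.subset_span ⟨s, t, e, he, rfl⟩)

namespace IsDoublyCommutingPair

variable {V₁ V₂ : ℝ≥0 → H →L[ℂ] H}

theorem bishiftPart_comm (h : IsDoublyCommutingPair V₁ V₂) :
    bishiftPart V₁ V₂ = bishiftPart V₂ V₁ := by
  unfold bishiftPart
  congr 2
  ext x
  constructor
  · rintro ⟨s, t, e, he, rfl⟩
    exact ⟨t, s, e, he.symm, h.apply_apply _ _ _⟩
  · rintro ⟨s, t, e, he, rfl⟩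
    exact ⟨t, s, e, he.symm, h.symm.apply_apply _ _ _⟩

variable (hV₁ : IsIsometricSemigroup V₁) (hV₂ : IsIsometricSemigroup V₂)

include hV₁ in
theorem starInvariant_bishiftPart_left (h : IsDoublyCommutingPair V₁ V₂) :
    StarInvariant V₁ (bishiftPart V₁ V₂) where
  apply_mem r x hx := by
    refine apply_mem_topologicalClosure_span _ ?_ hx
    rintro _ ⟨s, t, e, he, rfl⟩
    rw [← hV₁.map_add_apply]
    exact mem_bishiftPart V₁ V₂ _ _ he
  adjoint_mem r x hx := by
    refine apply_mem_topologicalClosure_span _ ?_ hx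
    rintro _ ⟨s, t, e, he, rfl⟩
    rcases le_total r s with hrs | hrs
    · rw [hV₁.adjoint_apply_of_le hrs]
      exact mem_bishiftPart V₁ V₂ _ _ he
    · rw [hV₁.adjoint_apply_of_ge hrs, h.starInvariant_expEigenspace.apply_mem t e he.1]
      refine Submodule.smul_of_tower_mem _ _ ?_
      have := mem_bishiftPart V₁ V₂ 0 t he
      rwa [hV₁.map_zero] at this

include hV₂ in
theorem starInvariant_bishiftPart_right (h : IsDoublyCommutingPair V₁ V₂) :
    StarInvariant V₂ (bishiftPart V₁ V₂) := by
  rw [h.bishiftPart_comm]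
  exact h.symm.starInvariant_bishiftPart_left hV₂

include hV₁ in
theorem bishiftPart_isOrtho_unitaryPart (h : IsDoublyCommutingPair V₁ V₂) :
    bishiftPart V₁ V₂ ⟂ unitaryPart V₁ := by
  have : CompleteSpace (unitaryPart V₁) := (isClosed_unitaryPart V₁).completeSpace_coe
  refine Submodule.topologicalClosure_minimal _ (Submodule.span_le.2 ?_)
    (Submodule.isClosed_orthogonal _)
  rintro _ ⟨s, t, e, he, rfl⟩ x hx
  rw [← ContinuousLinearMap.adjoint_inner_left, inner_eq_zero_symm]
  exact hV₁.inner_expEigenspace_unitaryPart (h.starInvariant_expEigenspace.apply_mem t e he.1)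
    (hV₁.starInvariant_unitaryPart.adjoint_mem s x hx)

/-- The part of a doubly commuting pair on which the first semigroup is pure and the second one is
unitary: the orthogonal complement of the bishift part and of the unitary part of `V₁`. -/
noncomputable def _root_.pureUnitaryPart (V₁ V₂ : ℝ≥0 → H →L[ℂ] H) : Submodule ℂ H :=
  (bishiftPart V₁ V₂ ⊔ unitaryPart V₁)ᗮ

include hV₁ in
theorem starInvariant_pureUnitaryPart_left (h : IsDoublyCommutingPair V₁ V₂) :
    StarInvariant V₁ (pureUnitaryPart V₁ V₂) :=
  ((h.starInvariant_bishiftPart_left hV₁).sup hV₁.starInvariant_unitaryPart).orthogonal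

include hV₂ in
theorem starInvariant_pureUnitaryPart_right (h : IsDoublyCommutingPair V₁ V₂) :
    StarInvariant V₂ (pureUnitaryPart V₁ V₂) :=
  ((h.starInvariant_bishiftPart_right hV₂).sup h.starInvariant_unitaryPart).orthogonal

include hV₁ hV₂ in
/-- `V₂` is unitary on the pure-unitary part `M`: the exponential eigenvectors of `V₂` in `M` form a
subspace that reduces `V₁` and contains no exponential eigenvector of `V₁`, so `V₁` is unitary on it
and it is zero. -/
theorem pureUnitaryPart_le_unitaryPart (h : IsDoublyCommutingPair V₁ V₂) :
    pureUnitaryPart V₁ V₂ ≤ unitaryPart V₂ := by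
  have hM : IsClosed (pureUnitaryPart V₁ V₂ : Set H) := Submodule.isClosed_orthogonal _
  have h1 := h.starInvariant_pureUnitaryPart_left hV₁
  have h2 := h.starInvariant_pureUnitaryPart_right hV₂
  have h3 := h1.inf h.symm.starInvariant_expEigenspace
  have hd : Disjoint (pureUnitaryPart V₁ V₂ ⊓ expEigenspace V₂) (expEigenspace V₁) := by
    refine Submodule.disjoint_def.2 fun x hx hx' => ?_
    have := mem_bishiftPart V₁ V₂ 0 0 ⟨hx', hx.2⟩
    rw [hV₁.map_zero, hV₂.map_zero, one_apply_eq_self, one_apply_eq_self] at this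
    exact inner_self_eq_zero.1 (hx.1 x (Submodule.mem_sup_left this))
  have hd' : Disjoint (pureUnitaryPart V₁ V₂) (expEigenspace V₂) := by
    refine Submodule.disjoint_def.2 fun x hx hx' => ?_
    have : x ∈ unitaryPart V₁ := fun t =>
      hV₁.apply_adjoint_of_disjoint (hM.inter (isClosed_expEigenspace V₂)) h3.apply_mem
        h3.adjoint_mem hd t ⟨hx, hx'⟩
    exact inner_self_eq_zero.1 (hx x (Submodule.mem_sup_right this))
  exact fun x hx t => hV₂.apply_adjoint_of_disjoint hM h2.apply_mem h2.adjoint_mem hd' t hx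

end IsDoublyCommutingPair

end Wold

/-! ### A unitary from equality of Gram matrices -/

section Gram

variable {ι X Y : Type*} [NormedAddCommGroup X] [InnerProductSpace ℂ X]
  [NormedAddCommGroup Y] [InnerProductSpace ℂ Y]

theorem inner_linearCombination_eq {v : ι → X} {w : ι → Y}
    (h : ∀ i j, ⟪v i, v j⟫_ℂ = ⟪w i, w j⟫_ℂ) (c d : ι →₀ ℂ) :
    ⟪Finsupp.linearCombination ℂ v c, Finsupp.linearCombination ℂ v d⟫_ℂ =
      ⟪Finsupp.linearCombination ℂ w c, Finsupp.linearCombination ℂ w d⟫_ℂ := by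
  induction c using Finsupp.induction_linear with
  | zero => simp
  | add c c' hc hc' => simp only [map_add, inner_add_left, hc, hc']
  | single i a =>
    induction d using Finsupp.induction_linear with
    | zero => simp
    | add d d' hd hd' => simp only [map_add, inner_add_right, hd, hd']
    | single j b =>
      simp only [Finsupp.linearCombination_single, inner_smul_left, inner_smul_right, h]

theorem denseRange_linearCombination {v : ι → X}
    (hv : (Submodule.span ℂ (range v)).topologicalClosure = ⊤) :
    DenseRange (Finsupp.linearCombination ℂ v) := by
  rw [← Submodule.dense_iff_topologicalClosure_eq_top] at hv
  rwa [DenseRange, ← LinearMap.coe_range, Finsupp.range_linearCombination]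

theorem exists_linearIsometryEquiv_of_inner_eq [CompleteSpace X] [CompleteSpace Y]
    {v : ι → X} {w : ι → Y} (h : ∀ i j, ⟪v i, v j⟫_ℂ = ⟪w i, w j⟫_ℂ)
    (hv : (Submodule.span ℂ (range v)).topologicalClosure = ⊤)
    (hw : (Submodule.span ℂ (range w)).topologicalClosure = ⊤) :
    ∃ W : X ≃ₗᵢ[ℂ] Y, ∀ i, W (v i) = w i := by
  have hnorm (c : ι →₀ ℂ) : ‖Finsupp.linearCombination ℂ w (LinearEquiv.refl ℂ (ι →₀ ℂ) c)‖ =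
      ‖Finsupp.linearCombination ℂ v c‖ := by
    rw [LinearEquiv.refl_apply, @norm_eq_sqrt_re_inner ℂ, @norm_eq_sqrt_re_inner ℂ,
      inner_linearCombination_eq h]
  refine ⟨(LinearEquiv.refl ℂ (ι →₀ ℂ)).extendOfIsometry (Finsupp.linearCombination ℂ v)
    (Finsupp.linearCombination ℂ w) (denseRange_linearCombination hv)
    (denseRange_linearCombination hw) hnorm, fun i => ?_⟩
  have := LinearEquiv.extendOfIsometry_eq (LinearEquiv.refl ℂ (ι →₀ ℂ))
    (Finsupp.linearCombination ℂ v) (Finsupp.linearCombination ℂ w)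
    (denseRange_linearCombination hv) (denseRange_linearCombination hw) hnorm (Finsupp.single i 1)
  simpa using this

end Gram

/-! ### Shifted exponentials on the quadrant -/

section Model

/-- The function `x ↦ exp (-(x - s))` on `[s, ∞)`, extended by zero. -/
noncomputable def expTail (s x : ℝ) : ℝ := if s ≤ x then Real.exp (-(x - s)) else 0

theorem measurable_expTail (s : ℝ) : Measurable (expTail s) :=
  Measurable.ite measurableSet_Ici (by fun_prop) measurable_const

theorem expTail_mul_expTail (s t : ℝ) : (fun x => expTail s x * expTail t x) =
    (Ici (max s t)).indicator fun x => Real.exp (s + t) * Real.exp (-2 * x) := by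
  ext x
  by_cases h : max s t ≤ x
  · have h' := max_le_iff.1 h
    rw [indicator_of_mem (by exact h), expTail, expTail, if_pos h'.1, if_pos h'.2, ← Real.exp_add,
      ← Real.exp_add]
    ring_nf
  · rw [indicator_of_notMem (by exact h), expTail, expTail]
    rw [max_le_iff, not_and_or] at h
    rcases h with h | h <;> simp [h]

theorem integral_expTail_mul_expTail (s t : ℝ≥0) :
    ∫ x in Ici (0 : ℝ), expTail s x * expTail t x = Real.exp (-|(s : ℝ) - t|) / 2 := by
  have h0 : (0 : ℝ) ≤ max (s : ℝ) t := le_max_of_le_left s.2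
  rw [expTail_mul_expTail, setIntegral_indicator measurableSet_Ici, Ici_inter_Ici,
    max_eq_right h0, integral_const_mul, integral_Ici_eq_integral_Ioi,
    integral_exp_mul_Ioi (by norm_num), neg_div_neg_eq, ← mul_div_assoc, ← Real.exp_add]
  congr 2
  rcases le_total (s : ℝ) t with h | h
  · rw [max_eq_right h, abs_of_nonpos (by linarith)]; ring
  · rw [max_eq_left h, abs_of_nonneg (by linarith)]; ring

theorem integrableOn_expTail_mul_expTail (s t : ℝ≥0) :
    Integrable (fun x => expTail s x * expTail t x) (volume.restrict (Ici (0 : ℝ))) :=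
  Integrable.of_integral_ne_zero (by rw [integral_expTail_mul_expTail]; positivity)

theorem quadrantMeasure_eq_prod : quadrantMeasure =
    (volume.restrict (Ici (0 : ℝ))).prod (volume.restrict (Ici (0 : ℝ))) := by
  rw [Measure.prod_restrict]; rfl

/-- The exponential with vertex `(s, t)` on the quadrant `[s, ∞) × [t, ∞)`, normalized in `L²`. -/
noncomputable def expKernel (s t : ℝ) (p : ℝ × ℝ) : ℝ := 2 * (expTail s p.1 * expTail t p.2)

theorem measurable_expKernel (s t : ℝ) : Measurable (expKernel s t) :=
  measurable_const.mul (((measurable_expTail s).comp measurable_fst).mul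
    ((measurable_expTail t).comp measurable_snd))

theorem memLp_expKernel (s t : ℝ≥0) : MemLp (expKernel s t) 2 quadrantMeasure := by
  rw [memLp_two_iff_integrable_sq_norm (measurable_expKernel s t).aestronglyMeasurable,
    quadrantMeasure_eq_prod]
  convert! ((integrableOn_expTail_mul_expTail s s).mul_prod
    (integrableOn_expTail_mul_expTail t t)).const_mul 4 using 2 with p
  rw [Real.norm_eq_abs, sq_abs, expKernel]
  ring

theorem integral_expKernel_mul_expKernel (s t s' t' : ℝ≥0) :
    ∫ p, expKernel s t p * expKernel s' t' p ∂quadrantMeasure =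
      Real.exp (-|(s : ℝ) - s'|) * Real.exp (-|(t : ℝ) - t'|) := by
  have h (p : ℝ × ℝ) : expKernel s t p * expKernel s' t' p =
      4 * ((expTail s p.1 * expTail s' p.1) * (expTail t p.2 * expTail t' p.2)) := by
    unfold expKernel; ring
  simp only [h]
  rw [integral_const_mul, quadrantMeasure_eq_prod,
    integral_prod_mul (fun x => expTail s x * expTail s' x) (fun x => expTail t x * expTail t' x),
    integral_expTail_mul_expTail, integral_expTail_mul_expTail]
  ring

/-- Inside the quadrant the shifted exponential is a multiple of the unshifted one, cut off. -/
theorem expKernel_eq_indicator (s t : ℝ≥0) {p : ℝ × ℝ} (hp : p ∈ Ici (0 : ℝ) ×ˢ Ici (0 : ℝ)) :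
    expKernel s t p =
      (Ici (s : ℝ) ×ˢ Ici (t : ℝ)).indicator (fun p => Real.exp (s + t) * expKernel 0 0 p) p := by
  have h1 : (0 : ℝ) ≤ p.1 := hp.1
  have h2 : (0 : ℝ) ≤ p.2 := hp.2
  by_cases hs : (s : ℝ) ≤ p.1
  · by_cases ht : (t : ℝ) ≤ p.2
    · rw [indicator_of_mem (show p ∈ Ici (s : ℝ) ×ˢ Ici (t : ℝ) from ⟨hs, ht⟩)]
      simp only [expKernel, expTail, if_pos hs, if_pos ht, if_pos h1, if_pos h2]
      rw [← Real.exp_add, ← Real.exp_add, mul_left_comm, ← Real.exp_add]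
      ring_nf
    · rw [indicator_of_notMem (fun h => ht h.2)]
      simp [expKernel, expTail, ht]
  · rw [indicator_of_notMem (fun h => hs h.1)]
    simp [expKernel, expTail, hs]

theorem expKernel_zero_pos {p : ℝ × ℝ} (hp : p ∈ Ici (0 : ℝ) ×ˢ Ici (0 : ℝ)) :
    0 < expKernel 0 0 p := by
  have h1 : (0 : ℝ) ≤ p.1 := hp.1
  have h2 : (0 : ℝ) ≤ p.2 := hp.2
  simp only [expKernel, expTail, if_pos h1, if_pos h2]
  positivity

variable {F : Type*} [NormedAddCommGroup F] [InnerProductSpace ℂ F]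

/-- The shifted exponential with coefficient `e`, as an element of `L²(ℝ₊², F)`. -/
noncomputable def expVector (s t : ℝ≥0) (e : F) : Lp F 2 quadrantMeasure :=
  (((ContinuousLinearMap.id ℝ ℝ).smulRight e).comp_memLp' (memLp_expKernel s t)).toLp _

theorem coeFn_expVector (s t : ℝ≥0) (e : F) :
    (expVector s t e : ℝ × ℝ → F) =ᵐ[quadrantMeasure] fun p => expKernel s t p • e :=
  MemLp.coeFn_toLp _

theorem inner_expVector (s t s' t' : ℝ≥0) (e f : F) :
    ⟪expVector s t e, expVector s' t' f⟫_ℂ =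
      ((Real.exp (-|(s : ℝ) - s'|) * Real.exp (-|(t : ℝ) - t'|) : ℝ) : ℂ) * ⟪e, f⟫_ℂ := by
  rw [L2.inner_def, ← integral_expKernel_mul_expKernel, ← integral_complex_ofReal,
    ← integral_mul_const]
  refine integral_congr_ae ?_
  filter_upwards [coeFn_expVector s t e, coeFn_expVector s' t' f] with p h1 h2
  rw [h1, h2, ← Complex.coe_smul, ← Complex.coe_smul, inner_smul_left, inner_smul_right,
    Complex.conj_ofReal, Complex.ofReal_mul]
  ring

/-- The quadrants `[s, ∞) × [t, ∞)` form a generating π-system, so a function on the quadrant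
whose integrals over them vanish is zero almost everywhere. -/
theorem ae_eq_zero_of_forall_setIntegral_Ici_prod [CompleteSpace F] {G : ℝ × ℝ → F}
    (hG : Integrable G quadrantMeasure)
    (h : ∀ s t : ℝ≥0, ∫ p in Ici (s : ℝ) ×ˢ Ici (t : ℝ), G p ∂quadrantMeasure = 0) :
    G =ᵐ[quadrantMeasure] 0 := by
  have hQ : MeasurableSet (Ici (0 : ℝ) ×ˢ Ici (0 : ℝ)) := measurableSet_Ici.prod measurableSet_Ici
  have htot : ∫ p, G p ∂quadrantMeasure = 0 := by
    rw [← h 0 0, quadrantMeasure, Measure.restrict_restrict (by exact hQ)]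
    simp
  have hgen : (inferInstance : MeasurableSpace (ℝ × ℝ)) =
      MeasurableSpace.generateFrom (image2 (· ×ˢ ·) (range Ici) (range Ici)) := by
    have hspan : IsCountablySpanning (range (Ici : ℝ → Set ℝ)) := by
      refine ⟨fun n : ℕ => Ici (-(n : ℝ)), fun n => ⟨_, rfl⟩, eq_univ_of_forall fun x => ?_⟩
      obtain ⟨n, hn⟩ := exists_nat_ge (-x)
      exact mem_iUnion.2 ⟨n, mem_Ici.2 (by linarith)⟩
    have hR : (inferInstance : MeasurableSpace ℝ) = MeasurableSpace.generateFrom (range Ici) := by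
      rw [← borel_eq_generateFrom_Ici]; exact BorelSpace.measurable_eq
    rw [← generateFrom_prod_eq hspan hspan, ← hR]
  refine hG.ae_eq_zero_of_forall_setIntegral_eq_zero fun A hA hfin => ?_
  -- The finiteness of the measure of `A` is not preserved by the induction and not needed.
  clear hfin
  induction A, hA using MeasurableSpace.induction_on_inter hgen
    (isPiSystem_Ici.prod isPiSystem_Ici) with
  | empty => simp
  | basic A hA =>
    obtain ⟨_, ⟨s, rfl⟩, _, ⟨t, rfl⟩, rfl⟩ := hA
    have hst := h s.toNNReal t.toNNReal
    rw [quadrantMeasure, Measure.restrict_restrict (measurableSet_Ici.prod measurableSet_Ici)]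
      at hst ⊢
    rw [← hst]
    simp only [prod_inter_prod, Ici_inter_Ici, Real.coe_toNNReal', max_assoc, max_self]
  | compl A hA ih =>
    rw [setIntegral_compl hA hG, ih, htot, sub_zero]
  | iUnion f hd hf ih =>
    rw [integral_iUnion hf hd hG.integrableOn]
    simp [ih]

theorem topologicalClosure_span_expVector [CompleteSpace F] :
    (Submodule.span ℂ (range fun i : ℝ≥0 × ℝ≥0 × F => expVector i.1 i.2.1 i.2.2)).topologicalClosure
      = ⊤ := by
  rw [Submodule.topologicalClosure_eq_top_iff, Submodule.eq_bot_iff]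
  intro g hg
  have hint : Integrable (fun p => expKernel 0 0 p • g p) quadrantMeasure := by
    rw [← memLp_one_iff_integrable]
    exact MemLp.smul (𝕜 := ℝ) (Lp.memLp g) (memLp_expKernel 0 0)
  have hQ : ∀ᵐ p ∂quadrantMeasure, p ∈ Ici (0 : ℝ) ×ˢ Ici (0 : ℝ) :=
    ae_restrict_mem (measurableSet_Ici.prod measurableSet_Ici)
  have hzero := ae_eq_zero_of_forall_setIntegral_Ici_prod hint fun s t => by
    refine ext_inner_left ℂ fun e => ?_
    have h0 := hg (expVector s t e) (Submodule.subset_span ⟨(s, t, e), rfl⟩)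
    rw [L2.inner_def] at h0
    have h1 : ∫ p, ⟪(expVector s t e : ℝ × ℝ → F) p, g p⟫_ℂ ∂quadrantMeasure =
        ∫ p, (Ici (s : ℝ) ×ˢ Ici (t : ℝ)).indicator
          (fun p => (Real.exp (s + t) : ℂ) * ⟪e, expKernel 0 0 p • g p⟫_ℂ) p ∂quadrantMeasure := by
      refine integral_congr_ae ?_
      filter_upwards [coeFn_expVector s t e, hQ] with p hp hpQ
      rw [hp, expKernel_eq_indicator s t hpQ]
      by_cases hpA : p ∈ Ici (s : ℝ) ×ˢ Ici (t : ℝ)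
      · rw [indicator_of_mem hpA, indicator_of_mem hpA, ← Complex.coe_smul, ← Complex.coe_smul,
          inner_smul_left, inner_smul_right, Complex.conj_ofReal, Complex.ofReal_mul, mul_assoc]
      · rw [indicator_of_notMem hpA, indicator_of_notMem hpA, zero_smul, inner_zero_left]
    rw [h1, integral_indicator (measurableSet_Ici.prod measurableSet_Ici), integral_const_mul,
      integral_inner hint.integrableOn] at h0
    rw [inner_zero_right]
    exact (mul_eq_zero.1 h0).resolve_left (by exact_mod_cast (Real.exp_pos _).ne')
  refine Lp.eq_zero_iff_ae_eq_zero.2 ?_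
  filter_upwards [hzero, hQ] with p hp hpQ
  exact (smul_eq_zero.1 hp).resolve_left (expKernel_zero_pos hpQ).ne'

end Model

/-! ### A criterion for bishift-semigroups -/

section Criterion

section Shift

variable {F : Type*} [NormedAddCommGroup F] [InnerProductSpace ℂ F]

theorem shiftFst_expKernel (r s t : ℝ≥0) (e : F) :
    shiftFst r (fun p => expKernel s t p • e) = fun p => expKernel (r + s : ℝ≥0) t p • e := by
  ext p
  have : (s : ℝ) ≤ p.1 - r ↔ ((r + s : ℝ≥0) : ℝ) ≤ p.1 := by
    rw [NNReal.coe_add, le_sub_iff_add_le']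
  unfold shiftFst expKernel expTail
  by_cases h : (r : ℝ) ≤ p.1
  · simp only [if_pos h, this, NNReal.coe_add]
    congr 5
    ring
  · have h' : ¬ ((r + s : ℝ≥0) : ℝ) ≤ p.1 := fun h' => h (le_trans (by simp) h')
    simp only [if_neg h, if_neg h', zero_mul, mul_zero, zero_smul]

theorem shiftSnd_expKernel (r s t : ℝ≥0) (e : F) :
    shiftSnd r (fun p => expKernel s t p • e) = fun p => expKernel s (r + t : ℝ≥0) p • e := by
  ext p
  have : (t : ℝ) ≤ p.2 - r ↔ ((r + t : ℝ≥0) : ℝ) ≤ p.2 := by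
    rw [NNReal.coe_add, le_sub_iff_add_le']
  unfold shiftSnd expKernel expTail
  by_cases h : (r : ℝ) ≤ p.2
  · simp only [if_pos h, this, NNReal.coe_add]
    congr 5
    ring
  · have h' : ¬ ((r + t : ℝ≥0) : ℝ) ≤ p.2 := fun h' => h (le_trans (by simp) h')
    simp only [if_neg h, if_neg h', mul_zero, zero_smul]

/-- Translating the quadrant into itself preserves null sets. -/
theorem ae_quadrantMeasure_sub {P : ℝ × ℝ → Prop} (h : ∀ᵐ p ∂quadrantMeasure, P p) (a : ℝ × ℝ) :
    ∀ᵐ p : ℝ × ℝ, p - a ∈ Ici (0 : ℝ) ×ˢ Ici (0 : ℝ) → P (p - a) := by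
  rw [quadrantMeasure, ae_restrict_iff' (measurableSet_Ici.prod measurableSet_Ici)] at h
  exact (measurePreserving_sub_right volume a).quasiMeasurePreserving.ae h

/-- An operation on functions on the quadrant that is linear and preserves almost everywhere
convergence of sequences. -/
structure IsShiftLike (σ : (ℝ × ℝ → F) → ℝ × ℝ → F) : Prop where
  map_add : ∀ f g, σ (f + g) = σ f + σ g
  map_smul : ∀ (c : ℂ) f, σ (c • f) = c • σ f
  tendsto : ∀ (f : ℕ → ℝ × ℝ → F) (g : ℝ × ℝ → F),
    (∀ᵐ p ∂quadrantMeasure, Tendsto (fun n => f n p) atTop (𝓝 (g p))) →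
    ∀ᵐ p ∂quadrantMeasure, Tendsto (fun n => σ (f n) p) atTop (𝓝 (σ g p))

theorem isShiftLike_shiftFst (r : ℝ≥0) : IsShiftLike (shiftFst r : (ℝ × ℝ → F) → ℝ × ℝ → F) where
  map_add f g := by
    ext p; by_cases h : (r : ℝ) ≤ p.1 <;> simp [shiftFst, h]
  map_smul c f := by
    ext p; by_cases h : (r : ℝ) ≤ p.1 <;> simp [shiftFst, h]
  tendsto f g h := by
    have := ae_quadrantMeasure_sub h (r, 0)
    refine (ae_restrict_iff' (measurableSet_Ici.prod measurableSet_Ici)).2 ?_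
    filter_upwards [this] with p hp hpQ
    obtain ⟨x, y⟩ := p
    by_cases h : (r : ℝ) ≤ x
    · simpa [shiftFst, h] using hp ⟨by simpa using h, by simpa using hpQ.2⟩
    · simp [shiftFst, h]

theorem isShiftLike_shiftSnd (r : ℝ≥0) : IsShiftLike (shiftSnd r : (ℝ × ℝ → F) → ℝ × ℝ → F) where
  map_add f g := by
    ext p; by_cases h : (r : ℝ) ≤ p.2 <;> simp [shiftSnd, h]
  map_smul c f := by
    ext p; by_cases h : (r : ℝ) ≤ p.2 <;> simp [shiftSnd, h]
  tendsto f g h := by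
    have := ae_quadrantMeasure_sub h (0, r)
    refine (ae_restrict_iff' (measurableSet_Ici.prod measurableSet_Ici)).2 ?_
    filter_upwards [this] with p hp hpQ
    obtain ⟨x, y⟩ := p
    by_cases h : (r : ℝ) ≤ y
    · simpa [shiftSnd, h] using hp ⟨by simpa using hpQ.1, by simpa using h⟩
    · simp [shiftSnd, h]

theorem IsShiftLike.congr_ae {σ : (ℝ × ℝ → F) → ℝ × ℝ → F} (hσ : IsShiftLike σ)
    {f g : ℝ × ℝ → F} (h : f =ᵐ[quadrantMeasure] g) : σ f =ᵐ[quadrantMeasure] σ g := by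
  have := hσ.tendsto (fun _ => f) g (h.mono fun p hp => by rw [hp]; exact tendsto_const_nhds)
  exact this.mono fun p hp => tendsto_nhds_unique tendsto_const_nhds hp

/-- The vectors on which `W` intertwines `T` with a shift form a closed subspace, because an
`L²`-convergent sequence has an almost everywhere convergent subsequence. It is therefore enough to
check the intertwining relation on a set with dense span. -/
theorem IsShiftLike.intertwines {X : Type*} [NormedAddCommGroup X] [InnerProductSpace ℂ X]
    {σ : (ℝ × ℝ → F) → ℝ × ℝ → F} (hσ : IsShiftLike σ) (W : X ≃ₗᵢ[ℂ] Lp F 2 quadrantMeasure)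
    (T : X →L[ℂ] X) {s : Set X} (hs : (Submodule.span ℂ s).topologicalClosure = ⊤)
    (h : ∀ x ∈ s, (W (T x) : ℝ × ℝ → F) =ᵐ[quadrantMeasure] σ (W x)) (x : X) :
    (W (T x) : ℝ × ℝ → F) =ᵐ[quadrantMeasure] σ (W x) := by
  let M : Submodule ℂ X :=
    { carrier := {x | (W (T x) : ℝ × ℝ → F) =ᵐ[quadrantMeasure] σ (W x)}
      add_mem' := fun {x y} hx hy => by
        have h1 := hσ.congr_ae (Lp.coeFn_add (W x) (W y))
        rw [hσ.map_add] at h1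
        change (W (T (x + y)) : ℝ × ℝ → F) =ᵐ[quadrantMeasure] σ (W (x + y))
        rw [T.map_add, W.map_add, W.map_add]
        filter_upwards [hx, hy, h1, Lp.coeFn_add (W (T x)) (W (T y))] with p h1 h2 h3 h4
        rw [h3, h4, Pi.add_apply, Pi.add_apply, h1, h2]
      zero_mem' := by
        have h1 := hσ.congr_ae (Lp.coeFn_zero F 2 quadrantMeasure)
        have h2 : σ 0 = 0 := by simpa using hσ.map_smul 0 0
        rw [h2] at h1
        change (W (T 0) : ℝ × ℝ → F) =ᵐ[quadrantMeasure] σ (W 0)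
        rw [map_zero, map_zero]
        exact (Lp.coeFn_zero F 2 quadrantMeasure).trans h1.symm
      smul_mem' := fun c x hx => by
        have h1 := hσ.congr_ae (Lp.coeFn_smul c (W x))
        rw [hσ.map_smul] at h1
        change (W (T (c • x)) : ℝ × ℝ → F) =ᵐ[quadrantMeasure] σ (W (c • x))
        rw [T.map_smul, W.map_smul, W.map_smul]
        filter_upwards [hx, h1, Lp.coeFn_smul c (W (T x))] with p h1 h3 h4
        rw [h3, h4, Pi.smul_apply, Pi.smul_apply, h1] }
  have hclosed : IsClosed (M : Set X) := by
    refine IsSeqClosed.isClosed fun y z hy hz => ?_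
    obtain ⟨φ, hφ, h1⟩ := (tendstoInMeasure_of_tendsto_Lp
      ((W.continuous.tendsto z).comp hz)).exists_seq_tendsto_ae
    obtain ⟨ψ, hψ, h2⟩ := (tendstoInMeasure_of_tendsto_Lp
      (((W.continuous.comp T.continuous).tendsto z).comp
        (hz.comp hφ.tendsto_atTop))).exists_seq_tendsto_ae
    have h3 := hσ.tendsto _ _ h1
    have h4 : ∀ᵐ p ∂quadrantMeasure, ∀ n, (W (T (y n)) : ℝ × ℝ → F) p = σ (W (y n)) p :=
      ae_all_iff.2 hy
    change (W (T z) : ℝ × ℝ → F) =ᵐ[quadrantMeasure] σ (W z)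
    filter_upwards [h2, h3, h4] with p h2 h3 h4
    refine tendsto_nhds_unique h2 ?_
    simp only [Function.comp_apply, h4]
    exact h3.comp hψ.tendsto_atTop
  have : (Submodule.span ℂ s).topologicalClosure ≤ M :=
    Submodule.topologicalClosure_minimal _ (Submodule.span_le.2 h) hclosed
  exact (hs ▸ this) (Submodule.mem_top : x ∈ ⊤)

end Shift

/-- A pair of commuting isometric semigroups is a bishift if the vectors `V₁ s (V₂ t (j e))`, with
`e` in a Hilbert space `F`, are total and have the Gram matrix of the shifted exponentials
in `L²(ℝ₊², F)`. -/
theorem isBishiftSemigroup_of_inner_eq {X F : Type u} [NormedAddCommGroup X] [InnerProductSpace ℂ X]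
    [CompleteSpace X] [NormedAddCommGroup F] [InnerProductSpace ℂ F] [CompleteSpace F]
    {V₁ V₂ : ℝ≥0 → X →L[ℂ] X} (hV₁ : ∀ r s x, V₁ (r + s) x = V₁ r (V₁ s x))
    (hV₂ : ∀ r s x, V₂ (r + s) x = V₂ r (V₂ s x)) (hc : ∀ r s x, V₁ r (V₂ s x) = V₂ s (V₁ r x))
    (j : F → X)
    (hinner : ∀ (s t s' t' : ℝ≥0) (e f : F), ⟪V₁ s (V₂ t (j e)), V₁ s' (V₂ t' (j f))⟫_ℂ =
      ((Real.exp (-|(s : ℝ) - s'|) * Real.exp (-|(t : ℝ) - t'|) : ℝ) : ℂ) * ⟪e, f⟫_ℂ)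
    (hdense : (Submodule.span ℂ
      (range fun i : ℝ≥0 × ℝ≥0 × F => V₁ i.1 (V₂ i.2.1 (j i.2.2)))).topologicalClosure = ⊤) :
    IsBishiftSemigroup V₁ V₂ := by
  obtain ⟨W, hW⟩ := exists_linearIsometryEquiv_of_inner_eq
    (v := fun i : ℝ≥0 × ℝ≥0 × F => V₁ i.1 (V₂ i.2.1 (j i.2.2)))
    (w := fun i : ℝ≥0 × ℝ≥0 × F => expVector i.1 i.2.1 i.2.2)
    (fun i k => by rw [hinner, inner_expVector]) hdense topologicalClosure_span_expVector
  have hW' (s t : ℝ≥0) (e : F) : W (V₁ s (V₂ t (j e))) = expVector s t e := hW (s, t, e)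
  refine ⟨F, inferInstance, inferInstance, inferInstance, W, fun r x => ⟨?_, ?_⟩⟩
  · refine (isShiftLike_shiftFst r).intertwines W (V₁ r) hdense ?_ x
    rintro _ ⟨⟨s, t, e⟩, rfl⟩
    simp only [← hV₁, hW']
    refine (coeFn_expVector _ _ _).trans (EventuallyEq.symm ?_)
    have := (isShiftLike_shiftFst r).congr_ae (coeFn_expVector s t e)
    rwa [shiftFst_expKernel] at this
  · refine (isShiftLike_shiftSnd r).intertwines W (V₂ r) hdense ?_ x
    rintro _ ⟨⟨s, t, e⟩, rfl⟩
    simp only [← hc, ← hV₂, hW']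
    refine (coeFn_expVector _ _ _).trans (EventuallyEq.symm ?_)
    have := (isShiftLike_shiftSnd r).congr_ae (coeFn_expVector s t e)
    rwa [shiftSnd_expKernel] at this

end Criterion

/-! ### Unitary groups extending an isometric semigroup -/

section UnitaryGroup

variable {K : Type*} [NormedAddCommGroup K] [InnerProductSpace ℂ K]

namespace IsUnitaryGroup

variable {U : ℝ → K →L[ℂ] K} (hU : IsUnitaryGroup U)
include hU

theorem map_add_apply (s t : ℝ) (x : K) : U (s + t) x = U s (U t x) := by
  rw [hU.map_add]; rfl

theorem neg_apply_apply (t : ℝ) (x : K) : U (-t) (U t x) = x := by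
  rw [← hU.map_add_apply, neg_add_cancel, hU.map_zero]; rfl

theorem apply_neg_apply (t : ℝ) (x : K) : U t (U (-t) x) = x := by
  rw [← hU.map_add_apply, add_neg_cancel, hU.map_zero]; rfl

theorem inner_map_map (t : ℝ) (x y : K) : ⟪U t x, U t y⟫_ℂ = ⟪x, y⟫_ℂ :=
  LinearIsometry.inner_map_map ⟨(U t).toLinearMap, hU.norm_map t⟩ x y

theorem inner_left (t : ℝ) (x y : K) : ⟪U t x, y⟫_ℂ = ⟪x, U (-t) y⟫_ℂ := by
  rw [← hU.inner_map_map (-t), hU.neg_apply_apply]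

theorem adjoint_eq [CompleteSpace K] (t : ℝ) : adjoint (U t) = U (-t) :=
  ContinuousLinearMap.ext fun x => ext_inner_left ℂ fun y => by
    rw [ContinuousLinearMap.adjoint_inner_right, hU.inner_left]

theorem orthogonal_mem {L : Submodule ℂ K} (hL : ∀ t, ∀ x ∈ L, U t x ∈ L) (t : ℝ) {x : K}
    (hx : x ∈ Lᗮ) : U t x ∈ Lᗮ := fun y hy => by
  rw [← inner_conj_symm, hU.inner_left, inner_conj_symm]
  exact hx _ (hL _ y hy)

theorem restrict {L : Submodule ℂ K} (hL : ∀ t, ∀ x ∈ L, U t x ∈ L) :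
    IsUnitaryGroup fun t => (U t).restrict (hL t) where
  map_zero := by ext x; exact DFunLike.congr_fun hU.map_zero (x : K)
  map_add s t := by ext x; exact hU.map_add_apply s t x
  continuous x := (hU.continuous (x : K)).subtype_mk _
  norm_map t x := hU.norm_map t x
  surjective t x := ⟨⟨U (-t) x, hL _ x x.2⟩, Subtype.ext (hU.apply_neg_apply t x)⟩

end IsUnitaryGroup

end UnitaryGroup

section Split

variable {H K : Type*} [NormedAddCommGroup H] [InnerProductSpace ℂ H]
  [NormedAddCommGroup K] [InnerProductSpace ℂ K]

theorem IsIsometricSemigroup.restrict {V : ℝ≥0 → H →L[ℂ] H} (hV : IsIsometricSemigroup V)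
    {M : Submodule ℂ H} (h : IsInvariantUnder V M) : IsIsometricSemigroup h.restrict where
  map_zero := by ext x; exact DFunLike.congr_fun hV.map_zero (x : H)
  map_add s t := by ext x; exact DFunLike.congr_fun (hV.map_add s t) (x : H)
  continuous x := (hV.continuous (x : H)).subtype_mk _
  norm_map t x := hV.norm_map t x

theorem mem_orthogonal_range {J : H →ₗᵢ[ℂ] K} {x : K} :
    x ∈ (LinearMap.range J.toLinearMap)ᗮ ↔ ∀ h, ⟪J h, x⟫_ℂ = 0 :=
  ⟨fun hx h => hx _ ⟨h, rfl⟩, by rintro hx _ ⟨h, rfl⟩; exact hx h⟩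

/-- The subspace `L` of `K` is closed, and the orthogonal projection onto `L` leaves `K ⊖ H`
invariant. It then leaves `H` invariant as well. -/
structure IsSplit (J : H →ₗᵢ[ℂ] K) (L : Submodule ℂ K) : Prop where
  isClosed : IsClosed (L : Set K)
  exists_sub_mem : ∀ d ∈ (LinearMap.range J.toLinearMap)ᗮ,
    ∃ a ∈ L, a ∈ (LinearMap.range J.toLinearMap)ᗮ ∧ d - a ∈ Lᗮ

variable {J : H →ₗᵢ[ℂ] K} [CompleteSpace H]

theorem exists_eq_of_inner_orthogonal_range_eq_zero {z : K}
    (hz : ∀ d ∈ (LinearMap.range J.toLinearMap)ᗮ, ⟪d, z⟫_ℂ = 0) : ∃ h, J h = z := by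
  have : CompleteSpace (LinearMap.range J.toLinearMap) :=
    (show IsComplete (Set.range J) from
      J.isometry.isUniformInducing.isComplete_range).completeSpace_coe
  have h : z ∈ (LinearMap.range J.toLinearMap)ᗮᗮ := hz
  rwa [Submodule.orthogonal_orthogonal] at h

variable [CompleteSpace K] {L : Submodule ℂ K}

theorem IsSplit.exists_map_sub_mem (hL : IsSplit J L) (h : H) :
    ∃ h', J h' ∈ L ∧ J h - J h' ∈ Lᗮ := by
  have : CompleteSpace L := hL.isClosed.completeSpace_coe
  obtain ⟨k, hk, b, hb, hkb⟩ := L.exists_add_mem_mem_orthogonal (J h)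
  have hsub : J h - k = b := by rw [hkb, add_sub_cancel_left]
  obtain ⟨h', rfl⟩ : ∃ h', J h' = k := by
    refine exists_eq_of_inner_orthogonal_range_eq_zero fun d hd => ?_
    obtain ⟨a, haL, haD, hda⟩ := hL.exists_sub_mem d hd
    have h1 : ⟪d - a, k⟫_ℂ = 0 := Submodule.inner_left_of_mem_orthogonal hk hda
    have h2 : ⟪a, J h - k⟫_ℂ = 0 := hsub ▸ hb a haL
    have h3 : ⟪a, J h⟫_ℂ = 0 := inner_eq_zero_symm.1 (mem_orthogonal_range.1 haD h)
    rw [inner_sub_right, h3, zero_sub, neg_eq_zero] at h2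
    rwa [inner_sub_left, h2, sub_zero] at h1
  exact ⟨h', hk, hsub ▸ hb⟩

theorem IsSplit.mem_orthogonal_comap (hL : IsSplit J L) {h : H} :
    h ∈ (L.comap J.toLinearMap)ᗮ ↔ J h ∈ Lᗮ := by
  constructor
  · intro hh
    obtain ⟨h', hL', horth⟩ := hL.exists_map_sub_mem h
    have h1 : ⟪J h', J h⟫_ℂ = 0 := by rw [J.inner_map_map]; exact hh h' hL'
    have h2 : ⟪J h', J h - J h'⟫_ℂ = 0 := horth _ hL'
    rw [inner_sub_right, h1, zero_sub, neg_eq_zero, inner_self_eq_zero] at h2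
    rwa [h2, sub_zero] at horth
  · intro hh k hk
    rw [← J.inner_map_map]
    exact hh _ hk

variable {V : ℝ≥0 → H →L[ℂ] H} {U : ℝ → K →L[ℂ] K}

theorem IsSplit.reduces (hL : IsSplit J L) (hU : IsUnitaryGroup U)
    (hext : ∀ (t : ℝ≥0) h, U t (J h) = J (V t h)) (hinv : ∀ t, ∀ x ∈ L, U t x ∈ L) :
    Reduces V (L.comap J.toLinearMap) where
  isClosed := hL.isClosed.preimage J.continuous
  invariant t x hx := by
    change J (V t x) ∈ L
    rw [← hext]
    exact hinv t _ hx
  invariant_orthogonal t x hx := by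
    rw [hL.mem_orthogonal_comap] at hx ⊢
    rw [← hext]
    exact hU.orthogonal_mem hinv t hx

omit [CompleteSpace H] [CompleteSpace K] in
theorem apply_mem_orthogonal_range (hU : IsUnitaryGroup U)
    (hext : ∀ (t : ℝ≥0) h, U t (J h) = J (V t h)) {t : ℝ} (ht : t ≤ 0) {d : K}
    (hd : d ∈ (LinearMap.range J.toLinearMap)ᗮ) : U t d ∈ (LinearMap.range J.toLinearMap)ᗮ := by
  rw [mem_orthogonal_range] at hd ⊢
  intro h
  obtain ⟨s, rfl⟩ : ∃ s : ℝ≥0, t = -s := ⟨⟨-t, neg_nonneg.2 ht⟩, (neg_neg t).symm⟩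
  rw [← hU.inner_left, hext]
  exact hd _

/-- `V` is unitary on `H ⊓ L` as soon as `U` leaves the part of `K ⊖ H` in `L` invariant. -/
theorem IsSplit.isUnitarySemigroup (hL : IsSplit J L) (hU : IsUnitaryGroup U)
    (hext : ∀ (t : ℝ≥0) h, U t (J h) = J (V t h)) (hV : IsIsometricSemigroup V)
    (hinv : ∀ t, ∀ x ∈ L, U t x ∈ L)
    (hD : ∀ t : ℝ≥0, ∀ a ∈ L, a ∈ (LinearMap.range J.toLinearMap)ᗮ →
      U t a ∈ (LinearMap.range J.toLinearMap)ᗮ) :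
    IsUnitarySemigroup (hL.reduces hU hext hinv).restrict where
  toIsIsometricSemigroup := hV.restrict _
  surjective t x := by
    have hx : J x ∈ L := x.2
    obtain ⟨y, hy⟩ : ∃ y, J y = U (-t) (J x) := by
      refine exists_eq_of_inner_orthogonal_range_eq_zero fun d hd => ?_
      obtain ⟨a, haL, haD, hda⟩ := hL.exists_sub_mem d hd
      have h1 : ⟪d - a, U (-t) (J x)⟫_ℂ = 0 :=
        Submodule.inner_left_of_mem_orthogonal (hinv _ _ hx) hda
      have h2 : ⟪a, U (-t) (J x)⟫_ℂ = 0 := by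
        rw [← hU.inner_left]
        exact inner_eq_zero_symm.1 (mem_orthogonal_range.1 (hD t a haL haD) _)
      rwa [inner_sub_left, h2, sub_zero] at h1
    refine ⟨⟨y, ?_⟩, Subtype.ext (J.injective ?_)⟩
    · change J y ∈ L
      rw [hy]
      exact hinv _ _ hx
    · change J (V t y) = J x
      rw [← hext, hy, hU.apply_neg_apply]

omit [CompleteSpace H] [CompleteSpace K] in
/-- A vector in the range of every `V t` is orthogonal to `U t a` for all real `t` and all `a` in
`K ⊖ H`. -/
theorem inner_map_apply_eq_zero (hU : IsUnitaryGroup U)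
    (hext : ∀ (t : ℝ≥0) h, U t (J h) = J (V t h)) {x : H} (hx : ∀ t, ∃ y, V t y = x) {a : K}
    (ha : a ∈ (LinearMap.range J.toLinearMap)ᗮ) (t : ℝ) : ⟪J x, U t a⟫_ℂ = 0 := by
  rcases le_total t 0 with ht | ht
  · exact mem_orthogonal_range.1 (apply_mem_orthogonal_range hU hext ht ha) x
  · lift t to ℝ≥0 using ht
    obtain ⟨y, rfl⟩ := hx t
    rw [← hext, hU.inner_map_map]
    exact mem_orthogonal_range.1 ha y

end Split

/-! ### Hulls of the parts of the dual pair -/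

section Hull

variable {H : Type u} [NormedAddCommGroup H] [InnerProductSpace ℂ H]
  {V₁ V₂ : ℝ≥0 → H →L[ℂ] H}

namespace MinimalUnitaryExtension

variable (E : MinimalUnitaryExtension V₁ V₂)

theorem commute_apply (t s : ℝ) (x : E.K) : E.U₁ t (E.U₂ s x) = E.U₂ s (E.U₁ t x) :=
  DFunLike.congr_fun (E.comm t s) x

theorem coe_dual₁ (t : ℝ≥0) (d : E.dualSpace) : (E.dual₁ t d : E.K) = E.U₁ (-t) d := by
  rw [← E.group₁.adjoint_eq]; rfl

theorem coe_dual₂ (t : ℝ≥0) (d : E.dualSpace) : (E.dual₂ t d : E.K) = E.U₂ (-t) d := by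
  rw [← E.group₂.adjoint_eq]; rfl

theorem isIsometricSemigroup_dual₁ : IsIsometricSemigroup E.dual₁ where
  map_zero := by
    ext d
    rw [coe_dual₁, NNReal.coe_zero, neg_zero, E.group₁.map_zero]; rfl
  map_add s t := by
    ext d
    rw [mul_apply_eq_comp, coe_dual₁, coe_dual₁, coe_dual₁, ← E.group₁.map_add_apply,
      NNReal.coe_add, neg_add]
  continuous d := by
    refine Topology.IsInducing.subtypeVal.continuous_iff.2 ?_
    simp only [Function.comp_def, coe_dual₁]
    exact (E.group₁.continuous (d : E.K)).comp (by fun_prop)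
  norm_map t d := by
    change ‖(E.dual₁ t d : E.K)‖ = ‖(d : E.K)‖
    rw [coe_dual₁, E.group₁.norm_map]

theorem isIsometricSemigroup_dual₂ : IsIsometricSemigroup E.dual₂ where
  map_zero := by
    ext d
    rw [coe_dual₂, NNReal.coe_zero, neg_zero, E.group₂.map_zero]; rfl
  map_add s t := by
    ext d
    rw [mul_apply_eq_comp, coe_dual₂, coe_dual₂, coe_dual₂, ← E.group₂.map_add_apply,
      NNReal.coe_add, neg_add]
  continuous d := by
    refine Topology.IsInducing.subtypeVal.continuous_iff.2 ?_
    simp only [Function.comp_def, coe_dual₂]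
    exact (E.group₂.continuous (d : E.K)).comp (by fun_prop)
  norm_map t d := by
    change ‖(E.dual₂ t d : E.K)‖ = ‖(d : E.K)‖
    rw [coe_dual₂, E.group₂.norm_map]

/-- The smallest closed subspace of `K` that contains the subspace `A` of `K ⊖ H` and reduces both
unitary groups. -/
noncomputable def hull (A : Submodule ℂ E.dualSpace) : Submodule ℂ E.K :=
  (Submodule.span ℂ {x | ∃ (t s : ℝ), ∃ a ∈ A, x = E.U₁ t (E.U₂ s a)}).topologicalClosure

variable {E} {A B : Submodule ℂ E.dualSpace}

theorem isClosed_hull : IsClosed (E.hull A : Set E.K) := Submodule.isClosed_topologicalClosure _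

theorem mem_hull {a : E.dualSpace} (ha : a ∈ A) (t s : ℝ) : E.U₁ t (E.U₂ s a) ∈ E.hull A :=
  Submodule.le_topologicalClosure _ (Submodule.subset_span ⟨t, s, a, ha, rfl⟩)

theorem coe_mem_hull {a : E.dualSpace} (ha : a ∈ A) : (a : E.K) ∈ E.hull A := by
  simpa [E.group₁.map_zero, E.group₂.map_zero] using mem_hull ha 0 0

theorem hull_le_orthogonal {L : Submodule ℂ E.K}
    (h : ∀ (t s : ℝ), ∀ a ∈ A, E.U₁ t (E.U₂ s a) ∈ Lᗮ) : E.hull A ≤ Lᗮ :=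
  Submodule.topologicalClosure_minimal _
    (Submodule.span_le.2 (by rintro _ ⟨t, s, a, ha, rfl⟩; exact h t s a ha))
    (Submodule.isClosed_orthogonal _)

theorem mem_orthogonal_hull {x : E.K}
    (h : ∀ (t s : ℝ), ∀ a ∈ A, ⟪x, E.U₁ t (E.U₂ s a)⟫_ℂ = 0) : x ∈ (E.hull A)ᗮ := by
  have : E.hull A ≤ (Submodule.span ℂ {x})ᗮ :=
    hull_le_orthogonal fun t s a ha => Submodule.mem_orthogonal_singleton_iff_inner_right.2
      (h t s a ha)
  exact fun y hy => Submodule.mem_orthogonal_singleton_iff_inner_left.1 (this hy)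

theorem U₁_mem_hull (t : ℝ) (x : E.K) (hx : x ∈ E.hull A) : E.U₁ t x ∈ E.hull A := by
  refine apply_mem_topologicalClosure_span _ ?_ hx
  rintro _ ⟨t', s, a, ha, rfl⟩
  rw [← E.group₁.map_add_apply]
  exact mem_hull ha _ _

theorem U₂_mem_hull (t : ℝ) (x : E.K) (hx : x ∈ E.hull A) : E.U₂ t x ∈ E.hull A := by
  refine apply_mem_topologicalClosure_span _ ?_ hx
  rintro _ ⟨t', s, a, ha, rfl⟩
  rw [← E.commute_apply, ← E.group₂.map_add_apply]
  exact mem_hull ha _ _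

/-- The action of the joint group on a subspace invariant under the dual pair, for times in the
negative quadrant. -/
theorem exists_coe_eq (h₁ : IsInvariantUnder E.dual₁ A) (h₂ : IsInvariantUnder E.dual₂ A)
    {t s : ℝ} (ht : t ≤ 0) (hs : s ≤ 0) {a : E.dualSpace} (ha : a ∈ A) :
    ∃ b ∈ A, (b : E.K) = E.U₁ t (E.U₂ s a) := by
  refine ⟨E.dual₁ (-t).toNNReal (E.dual₂ (-s).toNNReal a), h₁ _ _ (h₂ _ _ ha), ?_⟩
  rw [coe_dual₁, coe_dual₂, Real.coe_toNNReal _ (neg_nonneg.2 ht),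
    Real.coe_toNNReal _ (neg_nonneg.2 hs), neg_neg, neg_neg]

/-- Orthogonal invariant subspaces of `K ⊖ H` have orthogonal hulls: two vectors in the hulls can be
moved back into `K ⊖ H` by the same element of the joint group. -/
theorem hull_isOrtho (hA₁ : IsInvariantUnder E.dual₁ A) (hA₂ : IsInvariantUnder E.dual₂ A)
    (hB₁ : IsInvariantUnder E.dual₁ B) (hB₂ : IsInvariantUnder E.dual₂ B) (h : A ⟂ B) :
    E.hull A ⟂ E.hull B := by
  refine hull_le_orthogonal fun t s a ha => mem_orthogonal_hull fun t' s' b hb => ?_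
  obtain ⟨a', ha', haa⟩ := exists_coe_eq hA₁ hA₂ (sub_nonpos.2 (le_max_left t t'))
    (sub_nonpos.2 (le_max_left s s')) ha
  obtain ⟨b', hb', hbb⟩ := exists_coe_eq hB₁ hB₂ (sub_nonpos.2 (le_max_right t t'))
    (sub_nonpos.2 (le_max_right s s')) hb
  rw [← E.group₁.inner_map_map (-max t t'), ← E.group₂.inner_map_map (-max s s')]
  simp only [← E.group₁.map_add_apply, ← E.commute_apply, ← E.group₂.map_add_apply,
    neg_add_eq_sub]
  rw [← haa, ← hbb]
  have := h.symm hb' a' ha'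
  rwa [Submodule.coe_inner] at this

variable (hA₁ : StarInvariant E.dual₁ A) (hA₂ : StarInvariant E.dual₂ A)
  (hA : IsClosed (A : Set E.dualSpace))

include hA₁ hA₂ hA

/-- The projection onto the hull of `A` restricts to the projection of `K ⊖ H` onto `A`. -/
theorem exists_mem_sub_mem_orthogonal_hull (d : E.dualSpace) :
    ∃ a ∈ A, (d : E.K) - a ∈ (E.hull A)ᗮ := by
  have : CompleteSpace A := hA.completeSpace_coe
  obtain ⟨a, ha, b, hb, rfl⟩ := A.exists_add_mem_mem_orthogonal d
  refine ⟨a, ha, ?_⟩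
  rw [Submodule.coe_add, add_sub_cancel_left]
  exact (hull_isOrtho hA₁.apply_mem hA₂.apply_mem hA₁.orthogonal.apply_mem
    hA₂.orthogonal.apply_mem (Submodule.isOrtho_orthogonal_right A)).symm (coe_mem_hull hb)

theorem isSplit_hull : IsSplit E.J (E.hull A) where
  isClosed := isClosed_hull
  exists_sub_mem d hd := by
    obtain ⟨a, ha, h⟩ := exists_mem_sub_mem_orthogonal_hull hA₁ hA₂ hA ⟨d, hd⟩
    exact ⟨a, coe_mem_hull ha, a.2, h⟩

theorem mem_of_mem_hull {d : E.dualSpace} (hd : (d : E.K) ∈ E.hull A) : d ∈ A := by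
  obtain ⟨a, ha, h⟩ := exists_mem_sub_mem_orthogonal_hull hA₁ hA₂ hA d
  have : (d : E.K) - a = 0 :=
    inner_self_eq_zero.1 (h _ (Submodule.sub_mem _ hd (coe_mem_hull ha)))
  rwa [Subtype.ext (sub_eq_zero.1 this)]

omit hA₁ hA₂ hA

theorem coe_adjoint_dual₁ {a : E.dualSpace} (ha : a ∈ unitaryPart E.dual₁) (t : ℝ≥0) :
    (adjoint (E.dual₁ t) a : E.K) = E.U₁ t a := by
  conv_rhs => rw [← ha t, coe_dual₁, E.group₁.apply_neg_apply]

theorem coe_adjoint_dual₂ {a : E.dualSpace} (ha : a ∈ unitaryPart E.dual₂) (t : ℝ≥0) :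
    (adjoint (E.dual₂ t) a : E.K) = E.U₂ t a := by
  conv_rhs => rw [← ha t, coe_dual₂, E.group₂.apply_neg_apply]

/-- A star-invariant subspace on which the second dual semigroup is unitary is invariant under the
whole second group. -/
theorem exists_coe_eq_U₂ (hA₂ : StarInvariant E.dual₂ A) (hu : A ≤ unitaryPart E.dual₂) (s : ℝ)
    {a : E.dualSpace} (ha : a ∈ A) : ∃ b ∈ A, (b : E.K) = E.U₂ s a := by
  rcases le_total s 0 with hs | hs
  · refine ⟨E.dual₂ (-s).toNNReal a, hA₂.apply_mem _ _ ha, ?_⟩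
    rw [coe_dual₂, Real.coe_toNNReal _ (neg_nonneg.2 hs), neg_neg]
  · lift s to ℝ≥0 using hs
    exact ⟨_, hA₂.adjoint_mem s a ha, coe_adjoint_dual₂ (hu ha) s⟩

theorem exists_coe_eq_U₁ (hA₁ : StarInvariant E.dual₁ A) (hu : A ≤ unitaryPart E.dual₁) (s : ℝ)
    {a : E.dualSpace} (ha : a ∈ A) : ∃ b ∈ A, (b : E.K) = E.U₁ s a := by
  rcases le_total s 0 with hs | hs
  · refine ⟨E.dual₁ (-s).toNNReal a, hA₁.apply_mem _ _ ha, ?_⟩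
    rw [coe_dual₁, Real.coe_toNNReal _ (neg_nonneg.2 hs), neg_neg]
  · lift s to ℝ≥0 using hs
    exact ⟨_, hA₁.adjoint_mem s a ha, coe_adjoint_dual₁ (hu ha) s⟩

end MinimalUnitaryExtension

end Hull

/-! ### The summands of the decomposition -/

section Summands

variable {H : Type u} [NormedAddCommGroup H] [InnerProductSpace ℂ H] [CompleteSpace H]
  {V₁ V₂ : ℝ≥0 → H →L[ℂ] H}

omit [CompleteSpace H] in
theorem Reduces.exists_apply_eq {V : ℝ≥0 → H →L[ℂ] H} {M : Submodule ℂ H} (h : Reduces V M)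
    (hu : IsUnitarySemigroup h.restrict) (t : ℝ≥0) {x : H} (hx : x ∈ M) : ∃ y ∈ M, V t y = x := by
  obtain ⟨y, hy⟩ := hu.surjective t ⟨x, hx⟩
  exact ⟨y, y.2, congrArg Subtype.val hy⟩

namespace MinimalUnitaryExtension

variable (E : MinimalUnitaryExtension V₁ V₂)

/-- The minimal unitary extension of the restriction of `(V₁, V₂)` to the part of `H` in a subspace
`L` of `K` that splits and reduces both unitary groups: it acts on `L`. -/
noncomputable def restrict {L : Submodule ℂ E.K} (hL : IsSplit E.J L)
    (hL₁ : ∀ t, ∀ x ∈ L, E.U₁ t x ∈ L) (hL₂ : ∀ t, ∀ x ∈ L, E.U₂ t x ∈ L)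
    (h₁ : Reduces V₁ (L.comap E.J.toLinearMap)) (h₂ : Reduces V₂ (L.comap E.J.toLinearMap)) :
    MinimalUnitaryExtension h₁.restrict h₂.restrict where
  K := L
  completeSpace := hL.isClosed.completeSpace_coe
  J := ⟨E.J.toLinearMap.restrict fun _ hx => hx, fun x => E.J.norm_map x⟩
  U₁ t := (E.U₁ t).restrict (hL₁ t)
  U₂ t := (E.U₂ t).restrict (hL₂ t)
  group₁ := E.group₁.restrict hL₁
  group₂ := E.group₂.restrict hL₂
  comm t s := by ext x; exact E.commute_apply t s x
  extends₁ t x := Subtype.ext (E.extends₁ t x)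
  extends₂ t x := Subtype.ext (E.extends₂ t x)
  minimal := by
    have : CompleteSpace L := hL.isClosed.completeSpace_coe
    rw [Submodule.topologicalClosure_eq_top_iff, Submodule.eq_bot_iff]
    intro z hz
    have hE := E.minimal
    rw [Submodule.topologicalClosure_eq_top_iff, Submodule.eq_bot_iff] at hE
    refine Subtype.ext (hE z ?_)
    rw [Submodule.mem_orthogonal]
    -- The component of `J h` orthogonal to `L` does not contribute to the inner product with `z`.
    have key : Submodule.span ℂ {x | ∃ (t s : ℝ) (h : H), x = E.U₁ t (E.U₂ s (E.J h))} ≤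
        (Submodule.span ℂ {(z : E.K)})ᗮ := by
      refine Submodule.span_le.2 ?_
      rintro _ ⟨t, s, h, rfl⟩
      obtain ⟨h', hh', horth⟩ := hL.exists_map_sub_mem h
      have h1 : ⟪E.U₁ t (E.U₂ s (E.J h')), (z : E.K)⟫_ℂ = 0 :=
        hz _ (Submodule.subset_span ⟨t, s, ⟨h', hh'⟩, rfl⟩)
      have h2 : ⟪E.U₁ t (E.U₂ s (E.J h - E.J h')), (z : E.K)⟫_ℂ = 0 :=
        Submodule.inner_left_of_mem_orthogonal z.2
          (E.group₁.orthogonal_mem hL₁ t (E.group₂.orthogonal_mem hL₂ s horth))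
      rw [map_sub, map_sub, inner_sub_left, h1, sub_zero] at h2
      exact Submodule.mem_orthogonal_singleton_iff_inner_left.2 h2
    exact fun x hx => Submodule.mem_orthogonal_singleton_iff_inner_left.1 (key hx)

/-- The inclusion of the space of the restricted extension. -/
noncomputable def restrictInclusion {L : Submodule ℂ E.K} (hL : IsSplit E.J L)
    (hL₁ : ∀ t, ∀ x ∈ L, E.U₁ t x ∈ L) (hL₂ : ∀ t, ∀ x ∈ L, E.U₂ t x ∈ L)
    (h₁ : Reduces V₁ (L.comap E.J.toLinearMap)) (h₂ : Reduces V₂ (L.comap E.J.toLinearMap)) :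
    (E.restrict hL hL₁ hL₂ h₁ h₂).K →ₗᵢ[ℂ] E.K :=
  L.subtypeₗᵢ

variable {E}

theorem exists_restrictInclusion_eq {L : Submodule ℂ E.K} (hL : IsSplit E.J L)
    (hL₁ : ∀ t, ∀ x ∈ L, E.U₁ t x ∈ L) (hL₂ : ∀ t, ∀ x ∈ L, E.U₂ t x ∈ L)
    (h₁ : Reduces V₁ (L.comap E.J.toLinearMap)) (h₂ : Reduces V₂ (L.comap E.J.toLinearMap))
    {d : E.dualSpace} (hd : (d : E.K) ∈ L) :
    ∃ z : (E.restrict hL hL₁ hL₂ h₁ h₂).dualSpace, E.restrictInclusion hL hL₁ hL₂ h₁ h₂ z = d := by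
  refine ⟨⟨⟨d, hd⟩, ?_⟩, rfl⟩
  rintro _ ⟨h, rfl⟩
  exact mem_orthogonal_range.1 d.2 h

theorem restrictInclusion_mem_dualSpace {L : Submodule ℂ E.K} (hL : IsSplit E.J L)
    (hL₁ : ∀ t, ∀ x ∈ L, E.U₁ t x ∈ L) (hL₂ : ∀ t, ∀ x ∈ L, E.U₂ t x ∈ L)
    (h₁ : Reduces V₁ (L.comap E.J.toLinearMap)) (h₂ : Reduces V₂ (L.comap E.J.toLinearMap))
    (z : (E.restrict hL hL₁ hL₂ h₁ h₂).dualSpace) :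
    E.restrictInclusion hL hL₁ hL₂ h₁ h₂ z ∈ E.dualSpace := by
  refine mem_orthogonal_range.2 fun h => ?_
  obtain ⟨h', hh', horth⟩ := hL.exists_map_sub_mem h
  have h1 : ⟪E.J h', E.restrictInclusion hL hL₁ hL₂ h₁ h₂ z⟫_ℂ = 0 :=
    mem_orthogonal_range.1 z.2 ⟨h', hh'⟩
  have h2 : ⟪E.J h - E.J h', E.restrictInclusion hL hL₁ hL₂ h₁ h₂ z⟫_ℂ = 0 :=
    Submodule.inner_left_of_mem_orthogonal (Subtype.property (p := (· ∈ L)) z.1) horth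
  rwa [inner_sub_left, h1, sub_zero] at h2

omit [CompleteSpace H] in
/-- The dual of an extension `E'` is a bishift if `E'` embeds into `E` in such a way that its dual
space corresponds to the bishift part of the dual of `E`. -/
theorem isBishiftSemigroup_of_embedding (hd : IsDoublyCommutingPair E.dual₁ E.dual₂)
    {H' : Type u} [NormedAddCommGroup H'] [InnerProductSpace ℂ H'] {V₁' V₂' : ℝ≥0 → H' →L[ℂ] H'}
    (E' : MinimalUnitaryExtension V₁' V₂') (ι : E'.K →ₗᵢ[ℂ] E.K)
    (hι₁ : ∀ t x, ι (E'.U₁ t x) = E.U₁ t (ι x)) (hι₂ : ∀ t x, ι (E'.U₂ t x) = E.U₂ t (ι x))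
    (hmem : ∀ z : E'.dualSpace, ∃ d ∈ bishiftPart E.dual₁ E.dual₂, (d : E.K) = ι z)
    (hsurj : ∀ d ∈ bishiftPart E.dual₁ E.dual₂, ∃ z : E'.dualSpace, ι z = d) :
    IsBishiftSemigroup E'.dual₁ E'.dual₂ := by
  have hW₁ := E.isIsometricSemigroup_dual₁
  have hW₂ := E.isIsometricSemigroup_dual₂
  let N : Submodule ℂ E.dualSpace := expEigenspace E.dual₁ ⊓ expEigenspace E.dual₂
  have hN : IsClosed (N : Set E.dualSpace) :=
    (isClosed_expEigenspace E.dual₁).inter (isClosed_expEigenspace E.dual₂)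
  have : CompleteSpace N := hN.completeSpace_coe
  have hNb (e : N) : (e : E.dualSpace) ∈ bishiftPart E.dual₁ E.dual₂ := by
    have := mem_bishiftPart E.dual₁ E.dual₂ 0 0 e.2
    rwa [hW₁.map_zero, hW₂.map_zero] at this
  choose j hj using fun e : N => hsurj e (hNb e)
  have hcoe (s t : ℝ≥0) (e : N) :
      ι (E'.dual₁ s (E'.dual₂ t (j e))) = (E.dual₁ s (E.dual₂ t e) : E.K) := by
    rw [coe_dual₁, coe_dual₂, coe_dual₁, coe_dual₂, hι₁, hι₂, hj]
  refine isBishiftSemigroup_of_inner_eq E'.isIsometricSemigroup_dual₁.map_add_apply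
    E'.isIsometricSemigroup_dual₂.map_add_apply (fun r s x => ?_) j (fun s t s' t' e f => ?_) ?_
  · refine Subtype.ext ?_
    rw [coe_dual₁, coe_dual₂, coe_dual₂, coe_dual₁, commute_apply]
  · rw [Submodule.coe_inner, ← ι.inner_map_map, hcoe, hcoe, ← Submodule.coe_inner,
      hW₁.inner_apply_expEigenspace (hd.starInvariant_expEigenspace.apply_mem _ _ e.2.1)
        (hd.starInvariant_expEigenspace.apply_mem _ _ f.2.1),
      hW₂.inner_apply_expEigenspace e.2.2 f.2.2, Complex.ofReal_mul, mul_assoc,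
      Submodule.coe_inner N]
  · rw [Submodule.topologicalClosure_eq_top_iff, Submodule.eq_bot_iff]
    intro z hz
    obtain ⟨d, hdA, hdz⟩ := hmem z
    have hle : bishiftPart E.dual₁ E.dual₂ ≤ (Submodule.span ℂ {d})ᗮ := by
      refine Submodule.topologicalClosure_minimal _ (Submodule.span_le.2 ?_)
        (Submodule.isClosed_orthogonal _)
      rintro _ ⟨s, t, e, he, rfl⟩
      refine Submodule.mem_orthogonal_singleton_iff_inner_left.2 ?_
      have h := hz _ (Submodule.subset_span ⟨(s, t, ⟨e, he⟩), rfl⟩)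
      rwa [Submodule.coe_inner, ← ι.inner_map_map, hcoe, ← hdz, ← Submodule.coe_inner] at h
    have hd0 : d = 0 :=
      inner_self_eq_zero.1 (Submodule.mem_orthogonal_singleton_iff_inner_left.1 (hle hdA))
    refine Subtype.ext (ι.injective ?_)
    rw [← hdz, hd0, Submodule.coe_zero, Submodule.coe_zero, map_zero]

theorem isBishiftSemigroup_restrict (hd : IsDoublyCommutingPair E.dual₁ E.dual₂)
    (hL : IsSplit E.J (E.hull (bishiftPart E.dual₁ E.dual₂)))
    (h₁ : Reduces V₁ ((E.hull (bishiftPart E.dual₁ E.dual₂)).comap E.J.toLinearMap))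
    (h₂ : Reduces V₂ ((E.hull (bishiftPart E.dual₁ E.dual₂)).comap E.J.toLinearMap)) :
    IsBishiftSemigroup (E.restrict hL U₁_mem_hull U₂_mem_hull h₁ h₂).dual₁
      (E.restrict hL U₁_mem_hull U₂_mem_hull h₁ h₂).dual₂ := by
  refine isBishiftSemigroup_of_embedding hd _
    (E.restrictInclusion hL U₁_mem_hull U₂_mem_hull h₁ h₂) (fun _ _ => rfl) (fun _ _ => rfl)
    (fun z => ?_)
    (fun d hd' => exists_restrictInclusion_eq hL U₁_mem_hull U₂_mem_hull h₁ h₂ (coe_mem_hull hd'))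
  refine ⟨⟨_, restrictInclusion_mem_dualSpace hL U₁_mem_hull U₂_mem_hull h₁ h₂ z⟩, ?_, rfl⟩
  exact mem_of_mem_hull (hd.starInvariant_bishiftPart_left E.isIsometricSemigroup_dual₁)
    (hd.starInvariant_bishiftPart_right E.isIsometricSemigroup_dual₂) (isClosed_bishiftPart _ _)
    (Subtype.property (p := (· ∈ E.hull (bishiftPart E.dual₁ E.dual₂))) z.1)

section

variable (hV₁ : IsIsometricSemigroup V₁) (hV₂ : IsIsometricSemigroup V₂)
  {A : Submodule ℂ E.dualSpace} (hL : IsSplit E.J (E.hull A))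

omit [CompleteSpace H] in
theorem eq_bot_of_inner_hull_eq_zero
    {M : Submodule ℂ ((E.hull A).comap E.J.toLinearMap)}
    (h : ∀ x ∈ M, ∀ (t s : ℝ), ∀ a ∈ A, ⟪E.J x, E.U₁ t (E.U₂ s a)⟫_ℂ = 0) : M = ⊥ := by
  refine (Submodule.eq_bot_iff _).2 fun x hx => Subtype.ext (E.J.injective ?_)
  rw [Submodule.coe_zero, map_zero]
  exact inner_self_eq_zero.1 (mem_orthogonal_hull (h x hx) _ x.2)

omit [CompleteSpace H] in
include hV₁ hV₂ in
theorem isCnuPair_restrict (hcomm : IsCommutingPair V₁ V₂)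
    (h₁ : Reduces V₁ ((E.hull A).comap E.J.toLinearMap))
    (h₂ : Reduces V₂ ((E.hull A).comap E.J.toLinearMap)) :
    IsCnuPair h₁.restrict h₂.restrict where
  left := hV₁.restrict _
  right := hV₂.restrict _
  comm t s := by ext x; exact DFunLike.congr_fun (hcomm t s) (x : H)
  eq_bot M r₁ r₂ u₁ u₂ := by
    refine eq_bot_of_inner_hull_eq_zero fun x hx t s a _ => ?_
    -- `x = V₁ p (V₂ q z)` with `p`, `q` the positive parts of `t`, `s`, so that the inner product
    -- is that of `J z` with a vector of `K ⊖ H`.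
    obtain ⟨y, hy, rfl⟩ := r₁.exists_apply_eq u₁ t.toNNReal hx
    obtain ⟨z, -, rfl⟩ := r₂.exists_apply_eq u₂ s.toNNReal hy
    change ⟪E.J (V₁ t.toNNReal (V₂ s.toNNReal z)), _⟫_ℂ = 0
    rw [← E.extends₁, ← E.extends₂, ← E.group₁.inner_map_map (-t.toNNReal),
      E.group₁.neg_apply_apply, ← E.group₂.inner_map_map (-s.toNNReal), E.group₂.neg_apply_apply,
      ← E.group₁.map_add_apply, ← E.commute_apply, ← E.group₂.map_add_apply]
    refine mem_orthogonal_range.1 (apply_mem_orthogonal_range E.group₁ E.extends₁ ?_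
      (apply_mem_orthogonal_range E.group₂ E.extends₂ ?_ a.2)) _
    · simp [Real.coe_toNNReal']
    · simp [Real.coe_toNNReal']

omit [CompleteSpace H] in
include hV₁ in
theorem isCnuSemigroup_restrict₁ (hA₂ : StarInvariant E.dual₂ A) (hu : A ≤ unitaryPart E.dual₂)
    (h₁ : Reduces V₁ ((E.hull A).comap E.J.toLinearMap)) : IsCnuSemigroup h₁.restrict where
  toIsIsometricSemigroup := hV₁.restrict _
  eq_bot M r u := by
    refine eq_bot_of_inner_hull_eq_zero fun x hx t s a ha => ?_
    obtain ⟨b, -, hb⟩ := exists_coe_eq_U₂ hA₂ hu s ha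
    rw [← hb]
    refine inner_map_apply_eq_zero E.group₁ E.extends₁ (fun t => ?_) b.2 t
    obtain ⟨y, -, hy⟩ := r.exists_apply_eq u t hx
    exact ⟨y, congrArg Subtype.val hy⟩

omit [CompleteSpace H] in
include hV₂ in
theorem isCnuSemigroup_restrict₂ (hA₁ : StarInvariant E.dual₁ A) (hu : A ≤ unitaryPart E.dual₁)
    (h₂ : Reduces V₂ ((E.hull A).comap E.J.toLinearMap)) : IsCnuSemigroup h₂.restrict where
  toIsIsometricSemigroup := hV₂.restrict _
  eq_bot M r u := by
    refine eq_bot_of_inner_hull_eq_zero fun x hx t s a ha => ?_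
    obtain ⟨b, -, hb⟩ := exists_coe_eq_U₁ hA₁ hu t ha
    rw [E.commute_apply, ← hb]
    refine inner_map_apply_eq_zero E.group₂ E.extends₂ (fun t => ?_) b.2 s
    obtain ⟨y, -, hy⟩ := r.exists_apply_eq u t hx
    exact ⟨y, congrArg Subtype.val hy⟩

end

end MinimalUnitaryExtension

end Summands

open MinimalUnitaryExtension

theorem mainTheorem2 {H : Type u} [NormedAddCommGroup H] [InnerProductSpace ℂ H] [CompleteSpace H]
    (V₁ V₂ : ℝ≥0 → H →L[ℂ] H)
    (hV₁ : IsIsometricSemigroup V₁) (hV₂ : IsIsometricSemigroup V₂)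
    (hcomm : IsCommutingPair V₁ V₂)
    (hdual : IsDualDoublyCommuting V₁ V₂) :
    ∃ Hm Hpu Hup Huu : Submodule ℂ H,
      IsOrthogonalDirectSum ![Hm, Hpu, Hup, Huu] ∧
      (∃ (h₁ : Reduces V₁ Hm) (h₂ : Reduces V₂ Hm),
        IsModifiedBishiftSemigroup h₁.restrict h₂.restrict) ∧
      (∃ (h₁ : Reduces V₁ Hpu) (h₂ : Reduces V₂ Hpu),
        IsCnuSemigroup h₁.restrict ∧ IsUnitarySemigroup h₂.restrict) ∧
      (∃ (h₁ : Reduces V₁ Hup) (h₂ : Reduces V₂ Hup),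
        IsUnitarySemigroup h₁.restrict ∧ IsCnuSemigroup h₂.restrict) ∧
      (∃ (h₁ : Reduces V₁ Huu) (h₂ : Reduces V₂ Huu),
        IsUnitarySemigroup h₁.restrict ∧ IsUnitarySemigroup h₂.restrict) := by
  obtain ⟨E, hd⟩ := hdual
  have hW₁ := E.isIsometricSemigroup_dual₁
  have hW₂ := E.isIsometricSemigroup_dual₂
  set A := bishiftPart E.dual₁ E.dual₂
  set B := pureUnitaryPart E.dual₁ E.dual₂ with hB
  set C := unitaryPart E.dual₁
  have A₁ : StarInvariant E.dual₁ A := hd.starInvariant_bishiftPart_left hW₁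
  have A₂ : StarInvariant E.dual₂ A := hd.starInvariant_bishiftPart_right hW₂
  have B₁ : StarInvariant E.dual₁ B := hd.starInvariant_pureUnitaryPart_left hW₁
  have B₂ : StarInvariant E.dual₂ B := hd.starInvariant_pureUnitaryPart_right hW₂
  have C₁ : StarInvariant E.dual₁ C := hW₁.starInvariant_unitaryPart
  have C₂ : StarInvariant E.dual₂ C := hd.starInvariant_unitaryPart
  have hBu : B ≤ unitaryPart E.dual₂ := hd.pureUnitaryPart_le_unitaryPart hW₁ hW₂
  have Ac : IsClosed (A : Set E.dualSpace) := isClosed_bishiftPart _ _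
  have Bc : IsClosed (B : Set E.dualSpace) := Submodule.isClosed_orthogonal _
  have Cc : IsClosed (C : Set E.dualSpace) := isClosed_unitaryPart _
  have hAC : A ⟂ C := hd.bishiftPart_isOrtho_unitaryPart hW₁
  have hAB : A ⟂ B := (Submodule.isOrtho_orthogonal_right (A ⊔ C)).mono_left le_sup_left
  have hCB : C ⟂ B := (Submodule.isOrtho_orthogonal_right (A ⊔ C)).mono_left le_sup_right
  have oAB := hull_isOrtho A₁.apply_mem A₂.apply_mem B₁.apply_mem B₂.apply_mem hAB
  have oAC := hull_isOrtho A₁.apply_mem A₂.apply_mem C₁.apply_mem C₂.apply_mem hAC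
  have oBC := (hull_isOrtho C₁.apply_mem C₂.apply_mem B₁.apply_mem B₂.apply_mem hCB).symm
  have sA := isSplit_hull A₁ A₂ Ac
  have sB := isSplit_hull B₁ B₂ Bc
  have sC := isSplit_hull C₁ C₂ Cc
  set L : Submodule ℂ E.K := (E.hull A)ᗮ ⊓ (E.hull B)ᗮ ⊓ (E.hull C)ᗮ
  have L₁ (t : ℝ) (x : E.K) (hx : x ∈ L) : E.U₁ t x ∈ L :=
    ⟨⟨E.group₁.orthogonal_mem U₁_mem_hull t hx.1.1, E.group₁.orthogonal_mem U₁_mem_hull t hx.1.2⟩,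
      E.group₁.orthogonal_mem U₁_mem_hull t hx.2⟩
  have L₂ (t : ℝ) (x : E.K) (hx : x ∈ L) : E.U₂ t x ∈ L :=
    ⟨⟨E.group₂.orthogonal_mem U₂_mem_hull t hx.1.1, E.group₂.orthogonal_mem U₂_mem_hull t hx.1.2⟩,
      E.group₂.orthogonal_mem U₂_mem_hull t hx.2⟩
  -- `K ⊖ H` is contained in the sum of the three hulls, so `L` is contained in `H`.
  have hLD (d : E.dualSpace) : (d : E.K) ∈ Lᗮ := by
    have : CompleteSpace A := Ac.completeSpace_coe
    have : CompleteSpace C := Cc.completeSpace_coe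
    obtain ⟨a, ha, d', hd', rfl⟩ := A.exists_add_mem_mem_orthogonal d
    obtain ⟨c, hc, b, hb, rfl⟩ := C.exists_add_mem_mem_orthogonal d'
    have hbB : b ∈ B := by
      rw [hB, pureUnitaryPart, ← Submodule.inf_orthogonal]
      refine ⟨?_, hb⟩
      rw [← add_sub_cancel_left c b]
      exact Submodule.sub_mem _ hd' (hAC.symm hc)
    refine Submodule.add_mem _ ?_ (Submodule.add_mem _ ?_ ?_)
    · exact fun x hx => Submodule.inner_left_of_mem_orthogonal (coe_mem_hull ha) hx.1.1
    · exact fun x hx => Submodule.inner_left_of_mem_orthogonal (coe_mem_hull hc) hx.2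
    · exact fun x hx => Submodule.inner_left_of_mem_orthogonal (coe_mem_hull hbB) hx.1.2
  have sL : IsSplit E.J L :=
    { isClosed := ((Submodule.isClosed_orthogonal _).inter (Submodule.isClosed_orthogonal _)).inter
        (Submodule.isClosed_orthogonal _)
      exists_sub_mem := fun d hd => ⟨0, L.zero_mem, Submodule.zero_mem _, by
        rw [sub_zero]; exact hLD ⟨d, hd⟩⟩ }
  have hL0 {a : E.K} (ha : a ∈ L) (ha' : a ∈ (LinearMap.range E.J.toLinearMap)ᗮ) : a = 0 :=
    inner_self_eq_zero.1 (hLD ⟨a, ha'⟩ a ha)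
  have ortho {M N : Submodule ℂ E.K} (h : M ⟂ N) :
      M.comap E.J.toLinearMap ⟂ N.comap E.J.toLinearMap := fun x hx y hy => by
    rw [← E.J.inner_map_map]
    exact h hx _ hy
  have oAL : E.hull A ⟂ L := (Submodule.isOrtho_orthogonal_right _).mono_right
    (inf_le_left.trans inf_le_left)
  have oBL : E.hull B ⟂ L := (Submodule.isOrtho_orthogonal_right _).mono_right
    (inf_le_left.trans inf_le_right)
  have oCL : E.hull C ⟂ L := (Submodule.isOrtho_orthogonal_right _).mono_right inf_le_right
  refine ⟨(E.hull A).comap E.J.toLinearMap, (E.hull B).comap E.J.toLinearMap,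
    (E.hull C).comap E.J.toLinearMap, L.comap E.J.toLinearMap, ⟨?_, ?_⟩,
    ⟨sA.reduces E.group₁ E.extends₁ U₁_mem_hull, sA.reduces E.group₂ E.extends₂ U₂_mem_hull,
      isCnuPair_restrict hV₁ hV₂ hcomm _ _, _, isBishiftSemigroup_restrict hd sA _ _⟩,
    ⟨sB.reduces E.group₁ E.extends₁ U₁_mem_hull, sB.reduces E.group₂ E.extends₂ U₂_mem_hull,
      isCnuSemigroup_restrict₁ hV₁ B₂ hBu _,
      sB.isUnitarySemigroup E.group₂ E.extends₂ hV₂ U₂_mem_hull fun t a haL haD => ?_⟩,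
    ⟨sC.reduces E.group₁ E.extends₁ U₁_mem_hull, sC.reduces E.group₂ E.extends₂ U₂_mem_hull,
      sC.isUnitarySemigroup E.group₁ E.extends₁ hV₁ U₁_mem_hull fun t a haL haD => ?_,
      isCnuSemigroup_restrict₂ hV₂ C₁ le_rfl _⟩,
    ⟨sL.reduces E.group₁ E.extends₁ L₁, sL.reduces E.group₂ E.extends₂ L₂,
      sL.isUnitarySemigroup E.group₁ E.extends₁ hV₁ L₁ fun t a haL haD => ?_,
      sL.isUnitarySemigroup E.group₂ E.extends₂ hV₂ L₂ fun t a haL haD => ?_⟩⟩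
  · intro i k hik
    fin_cases i <;> fin_cases k <;> first | exact absurd rfl hik | skip
    exacts [ortho oAB, ortho oAC, ortho oAL, (ortho oAB).symm, ortho oBC, ortho oBL,
      (ortho oAC).symm, (ortho oBC).symm, ortho oCL, (ortho oAL).symm, (ortho oBL).symm,
      (ortho oCL).symm]
  · refine (Submodule.eq_top_iff').2 fun h => ?_
    obtain ⟨a, ha, ha'⟩ := sA.exists_map_sub_mem h
    obtain ⟨b, hb, hb'⟩ := sB.exists_map_sub_mem h
    obtain ⟨c, hc, hc'⟩ := sC.exists_map_sub_mem h
    have hrest : h - a - b - c ∈ L.comap E.J.toLinearMap := by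
      change E.J (h - a - b - c) ∈ L
      simp only [map_sub]
      refine ⟨⟨Submodule.sub_mem _ (Submodule.sub_mem _ ha' (oAB.symm hb)) (oAC.symm hc), ?_⟩, ?_⟩
      · rw [sub_right_comm (E.J h)]
        exact Submodule.sub_mem _ (Submodule.sub_mem _ hb' (oAB ha)) (oBC.symm hc)
      · rw [sub_right_comm _ _ (E.J c), sub_right_comm (E.J h)]
        exact Submodule.sub_mem _ (Submodule.sub_mem _ hc' (oAC ha)) (oBC hb)
    have hsum : h = a + b + c + (h - a - b - c) := by abel
    rw [hsum]
    refine Submodule.add_mem _ (Submodule.add_mem _ (Submodule.add_mem _ ?_ ?_) ?_) ?_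
    · exact Submodule.mem_iSup_of_mem 0 ha
    · exact Submodule.mem_iSup_of_mem 1 hb
    · exact Submodule.mem_iSup_of_mem 2 hc
    · exact Submodule.mem_iSup_of_mem 3 hrest
  · obtain ⟨b, -, hb⟩ := exists_coe_eq_U₂ B₂ hBu t (mem_of_mem_hull B₁ B₂ Bc (d := ⟨a, haD⟩) haL)
    rw [← hb]
    exact b.2
  · obtain ⟨b, -, hb⟩ := exists_coe_eq_U₁ C₁ le_rfl t
      (mem_of_mem_hull C₁ C₂ Cc (d := ⟨a, haD⟩) haL)
    rw [← hb]
    exact b.2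
  · rw [hL0 haL haD, map_zero]
    exact Submodule.zero_mem _
  · rw [hL0 haL haD, map_zero]
    exact Submodule.zero_mem _
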